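/- There is a universal constant $C>0$ such that the following holds. Let $n\ge 3$ and $p\ge 1$ be integers, and let $X_1,\dots,X_n$ be independent random vectors in $\mathbb{R}^p$, defined on a probability space $(\Omega,\mathcal{A},\mathbb{P})$, with $\mathbb{E}[X_{ij}]=0$ and $\mathbb{E}[|X_{ij}|^3]<\infty$ for all $1\le i\le n$, $1\le j\le p$. Suppose that there is a uniform random variable on $(0,1)$ defined on $(\Omega,\mathcal{A},\mathbb{P})$ and independent of $(X_1,\dots,X_n)$. Let $Y_1,\dots,Y_n$ be independent random vectors in $\mathbb{R}^p$ (on some probability space) with $Y_i\sim N(0,\mathbb{E}[X_iX_i^T])$ for $1\le i\le n$, and put $Z=\max_{1\le j\le p}\sum_{i=1}^n X_{ij}$. Then for every $\delta>0$ there is a random variable $\widetilde Z$ on $(\Omega,\mathcal{A},\mathbb{P})$, with the same distribution as $\max_{1\le j\le p}\sum_{i=1}^n Y_{ij}$, such that $$\mathbb{P}\big(|Z-\widetilde Z|>16\delta\big)\le C\left[\delta^{-2}\big\{B_1+\delta^{-1}(B_2+B_4)\log(p\vee n)\big\}\log(p\vee n)+\frac{\log n}{n}\right],$$ where $p\vee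 n=\max\{p,n\}$ and $$B_1=\mathbb{E}\Big[\max_{1\le j,k\le p}\Big|\sum_{i=1}^n\big(X_{ij}X_{ik}-\mathbb{E}[X_{ij}X_{ik}]\big)\Big|\Big],\qquad B_2=\mathbb{E}\Big[\max_{1\le j\le p}\sum_{i=1}^n|X_{ij}|^3\Big],$$ $$B_4=\sum_{i=1}^n\mathbb{E}\Big[\max_{1\le j\le p}|X_{ij}|^3\cdot 1\Big(\max_{1\le j\le p}|X_{ij}|>\frac{\delta}{\log(p\vee n)}\Big)\Big].$$ -/

import Mathlib

open MeasureTheory ProbabilityTheory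

noncomputable section

namespace MaxCoupling

variable {Ω : Type*} [MeasurableSpace Ω] {n p : ℕ}

/-- The maximal coordinate `max_{j} x_j` of a vector (all uses have `p ≥ 1`, so this is
a genuine maximum of a nonempty finite family). -/
def maxCoord (x : EuclideanSpace ℝ (Fin p)) : ℝ := ⨆ j, x j

/-- The maximal absolute coordinate `max_{j} |x_j|`. -/
def maxAbs (x : EuclideanSpace ℝ (Fin p)) : ℝ := ⨆ j, |x j|

/-- The matrix of second moments `E[X Xᵀ]` of a random vector `X`. -/
def secondMoment (μ : Measure Ω) (X : Ω → EuclideanSpace ℝ (Fin p)) :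
    Matrix (Fin p) (Fin p) ℝ :=
  Matrix.of fun j k => ∫ ω, X ω j * X ω k ∂μ

/-- The probability space `(Ω, μ)` carries a uniform random variable on `(0,1)` that is
independent of the random element `V`. -/
def HasIndepUniform {E : Type*} [MeasurableSpace E] (μ : Measure Ω) (V : Ω → E) : Prop :=
  ∃ U : Ω → ℝ, Measurable U ∧ pdf.IsUniform U (Set.Ioo 0 1) μ ∧ IndepFun U V μ

/-- `E[max_{j,k} |∑ᵢ (X_{ij} X_{ik} - E[X_{ij} X_{ik}])|]`. -/
def B₁ (μ : Measure Ω) (X : Fin n → Ω → EuclideanSpace ℝ (Fin p)) : ℝ :=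
  ∫ ω, ⨆ jk : Fin p × Fin p,
    |∑ i, (X i ω jk.1 * X i ω jk.2 - ∫ ω', X i ω' jk.1 * X i ω' jk.2 ∂μ)| ∂μ

/-- `E[max_{j} ∑ᵢ |X_{ij}|³]`. -/
def B₂ (μ : Measure Ω) (X : Fin n → Ω → EuclideanSpace ℝ (Fin p)) : ℝ :=
  ∫ ω, ⨆ j : Fin p, ∑ i, |X i ω j| ^ 3 ∂μ

/-- `∑ᵢ E[max_{j} |X_{ij}|³ · 1(max_{j} |X_{ij}| > δ / log (p ∨ n))]`. -/
def B₄ (μ : Measure Ω) (X : Fin n → Ω → EuclideanSpace ℝ (Fin p)) (δ : ℝ) : ℝ :=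
  ∑ i, ∫ ω, Set.indicator {ω | δ / Real.log (max (p : ℝ) (n : ℝ)) < maxAbs (X i ω)}
    (fun ω => ⨆ j : Fin p, |X i ω j| ^ 3) ω ∂μ

end MaxCoupling

end

/-! The coupling comes from Strassen's principle: a variable with law ν can be built close to Z,
outside an event of probability about ε, once P(Z ∈ A) ≤ ν(A') + ε for every A in a rich class,
where A' is a neighbourhood of A. Here A is a finite union of cells of a grid of mesh δ, so the
condition reduces to that of Hall's marriage theorem for finitely many cells, and the independent
uniform variable supplies the randomization (`exists_subcoupling`, `exists_coupling`,
`exists_grid_coupling`).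

To check the condition, the indicator of A is replaced by g(F(x)), where g is a cutoff varying at
scale δ and F is the log-sum-exp soft maximum with β = log(p ∨ n)/δ, which exceeds the maximum by at
most δ. The r-th derivative of g costs δ^{-r}, with constants independent of A
(`exists_smooth_cutoff`). Each derivative of F after the first costs a factor β; these derivatives
are cumulants under the Gibbs weights, which sum to one, so no power of p appears.

It remains to compare g(F(·)) in expectation at ∑ X_i and at a centered Gaussian Y of the same
covariance (`abs_integral_comp_smoothMax_sub_le`). Along W = sin θ ∑ X_i + cos θ Y, Gaussian
integration by parts turns the Y part of the derivative into a Hessian at W contracted with the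
covariance. Each X_i part is compared with its value at W - sin θ X_i, which has mean zero by
independence and centering; the first correction is again a Hessian at W. Since all Hessians share
the base point W, they combine into one, contracted with ∑ X_i X_iᵀ minus its mean, and this gives
B₁. The remainders are Gibbs means of |X_ij|³. When β|X_ij| ≤ 1 for all j they can be moved to W at
the cost of a factor e², and summing over i inside one Gibbs mean gives B₂, with the maximum outside
the sum. The remaining, large X_i account for B₄. -/

namespace MaxCoupling

/-! ### Gibbs means, the soft maximum and its derivatives. -/

variable {ι : Type*} [Fintype ι]

/-- The Gibbs weights `exp (β x_j) / ∑ₖ exp (β x_k)`. -/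
noncomputable def gibbs (β : ℝ) (x : ι → ℝ) (j : ι) : ℝ :=
  Real.exp (β * x j) / ∑ k, Real.exp (β * x k)

/-- The mean of `u` under the Gibbs weights at `x`. -/
noncomputable def gibbsMean (β : ℝ) (x u : ι → ℝ) : ℝ := ∑ j, gibbs β x j * u j

/-- The log-sum-exp approximation of the maximum. -/
noncomputable def smoothMax (β : ℝ) (x : ι → ℝ) : ℝ :=
  β⁻¹ * Real.log (∑ j, Real.exp (β * x j))

lemma sum_exp_pos [Nonempty ι] (β : ℝ) (x : ι → ℝ) : 0 < ∑ k, Real.exp (β * x k) :=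
  Finset.sum_pos (fun _ _ => Real.exp_pos _) Finset.univ_nonempty

lemma gibbs_nonneg (β : ℝ) (x : ι → ℝ) (j : ι) : 0 ≤ gibbs β x j := by
  unfold gibbs; positivity

lemma sum_gibbs [Nonempty ι] (β : ℝ) (x : ι → ℝ) : ∑ j, gibbs β x j = 1 := by
  unfold gibbs
  rw [← Finset.sum_div, div_self (sum_exp_pos β x).ne']

lemma gibbsMean_mono (β : ℝ) (x : ι → ℝ) {u v : ι → ℝ} (h : ∀ j, u j ≤ v j) :
    gibbsMean β x u ≤ gibbsMean β x v :=
  Finset.sum_le_sum fun j _ => mul_le_mul_of_nonneg_left (h j) (gibbs_nonneg β x j)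

lemma gibbsMean_nonneg (β : ℝ) (x : ι → ℝ) {u : ι → ℝ} (h : ∀ j, 0 ≤ u j) :
    0 ≤ gibbsMean β x u :=
  Finset.sum_nonneg fun j _ => mul_nonneg (gibbs_nonneg β x j) (h j)

lemma gibbsMean_add (β : ℝ) (x u v : ι → ℝ) :
    gibbsMean β x (fun j => u j + v j) = gibbsMean β x u + gibbsMean β x v := by
  simp [gibbsMean, mul_add, Finset.sum_add_distrib]

lemma gibbsMean_sub (β : ℝ) (x u v : ι → ℝ) :
    gibbsMean β x (fun j => u j - v j) = gibbsMean β x u - gibbsMean β x v := by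
  simp [gibbsMean, mul_sub, Finset.sum_sub_distrib]

lemma gibbsMean_smul (β : ℝ) (x : ι → ℝ) (c : ℝ) (u : ι → ℝ) :
    gibbsMean β x (fun j => c * u j) = c * gibbsMean β x u := by
  simp only [gibbsMean, Finset.mul_sum]
  exact Finset.sum_congr rfl fun j _ => by ring

lemma gibbsMean_sum {κ : Type*} (s : Finset κ) (β : ℝ) (x : ι → ℝ) (u : κ → ι → ℝ) :
    gibbsMean β x (fun j => ∑ i ∈ s, u i j) = ∑ i ∈ s, gibbsMean β x (u i) := by
  simp only [gibbsMean, Finset.mul_sum]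
  exact Finset.sum_comm

lemma gibbsMean_const [Nonempty ι] (β : ℝ) (x : ι → ℝ) (c : ℝ) :
    gibbsMean β x (fun _ => c) = c := by
  simp [gibbsMean, ← Finset.sum_mul, sum_gibbs]

lemma abs_gibbsMean_le (β : ℝ) (x u : ι → ℝ) :
    |gibbsMean β x u| ≤ gibbsMean β x (fun j => |u j|) := by
  refine (Finset.abs_sum_le_sum_abs _ _).trans (Finset.sum_le_sum fun j _ => ?_)
  rw [abs_mul, abs_of_nonneg (gibbs_nonneg β x j)]

lemma gibbsMean_le_of_le [Nonempty ι] (β : ℝ) (x : ι → ℝ) {u : ι → ℝ} {c : ℝ}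
    (h : ∀ j, u j ≤ c) : gibbsMean β x u ≤ c :=
  (gibbsMean_mono β x h).trans_eq (gibbsMean_const β x c)

/-- The Gibbs variance is nonnegative. -/
lemma sq_gibbsMean_le [Nonempty ι] (β : ℝ) (x u : ι → ℝ) :
    gibbsMean β x u ^ 2 ≤ gibbsMean β x (fun j => u j ^ 2) := by
  set t := gibbsMean β x u with ht
  have h : 0 ≤ gibbsMean β x (fun j => (u j - t) ^ 2) := gibbsMean_nonneg β x fun j => sq_nonneg _
  have e : gibbsMean β x (fun j => (u j - t) ^ 2)
      = gibbsMean β x (fun j => u j ^ 2) - 2 * t * t + t ^ 2 := by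
    have : (fun j => (u j - t) ^ 2) = fun j => (u j ^ 2 - 2 * t * u j) + t ^ 2 := by
      funext j; ring
    rw [this, gibbsMean_add β x (fun j => u j ^ 2 - 2 * t * u j) (fun _ => t ^ 2),
      gibbsMean_sub β x (fun j => u j ^ 2) (fun j => 2 * t * u j), gibbsMean_smul,
      gibbsMean_const]
  nlinarith

/-- With t the mean of a, average (a - t)² (a + t) ≥ 0: the terms in t³ cancel. -/
lemma gibbsMean_mul_sq_le [Nonempty ι] (β : ℝ) (x : ι → ℝ) {a : ι → ℝ} (ha : ∀ j, 0 ≤ a j) :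
    gibbsMean β x a * gibbsMean β x (fun j => a j ^ 2) ≤ gibbsMean β x (fun j => a j ^ 3) := by
  set t := gibbsMean β x a with ht
  have ht0 : 0 ≤ t := gibbsMean_nonneg β x ha
  have h : 0 ≤ gibbsMean β x (fun j => (a j - t) ^ 2 * (a j + t)) :=
    gibbsMean_nonneg β x fun j => mul_nonneg (sq_nonneg _) (add_nonneg (ha j) ht0)
  have e : gibbsMean β x (fun j => (a j - t) ^ 2 * (a j + t))
      = gibbsMean β x (fun j => a j ^ 3) - t * gibbsMean β x (fun j => a j ^ 2)
        - (t ^ 2 * t) + t ^ 3 := by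
    have : (fun j => (a j - t) ^ 2 * (a j + t))
        = fun j => (a j ^ 3 - t * a j ^ 2 - t ^ 2 * a j) + t ^ 3 := by
      funext j; ring
    rw [this, gibbsMean_add β x (fun j => a j ^ 3 - t * a j ^ 2 - t ^ 2 * a j) (fun _ => t ^ 3),
      gibbsMean_sub β x (fun j => a j ^ 3 - t * a j ^ 2) (fun j => t ^ 2 * a j),
      gibbsMean_sub β x (fun j => a j ^ 3) (fun j => t * a j ^ 2), gibbsMean_smul,
      gibbsMean_smul, gibbsMean_const]
  nlinarith

/-- The numerator grows by at most a factor e and the denominator shrinks by at most a factor e. -/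
lemma gibbs_add_le [Nonempty ι] {β : ℝ} (x y : ι → ℝ) (hy : ∀ j, |β * y j| ≤ 1) (j : ι) :
    gibbs β (x + y) j ≤ Real.exp 2 * gibbs β x j := by
  have hS := sum_exp_pos β x
  have hS' := sum_exp_pos β (x + y)
  have h1 : Real.exp (-1) * ∑ k, Real.exp (β * x k) ≤ ∑ k, Real.exp (β * (x + y) k) := by
    rw [Finset.mul_sum]
    refine Finset.sum_le_sum fun k _ => ?_
    rw [← Real.exp_add, Real.exp_le_exp, Pi.add_apply, mul_add]
    linarith [(abs_le.mp (hy k)).1]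
  have h2 : Real.exp (β * (x + y) j) ≤ Real.exp 1 * Real.exp (β * x j) := by
    rw [← Real.exp_add, Real.exp_le_exp, Pi.add_apply, mul_add]
    linarith [(abs_le.mp (hy j)).2]
  have he : Real.exp 2 * Real.exp (-1) = Real.exp 1 := by rw [← Real.exp_add]; norm_num
  unfold gibbs
  rw [← mul_div_assoc, div_le_div_iff₀ hS' hS]
  calc Real.exp (β * (x + y) j) * ∑ k, Real.exp (β * x k)
      ≤ Real.exp 1 * Real.exp (β * x j) * ∑ k, Real.exp (β * x k) := by gcongr
    _ = Real.exp 2 * Real.exp (β * x j) * (Real.exp (-1) * ∑ k, Real.exp (β * x k)) := by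
        rw [← he]; ring
    _ ≤ _ := by gcongr

lemma gibbsMean_add_le [Nonempty ι] {β : ℝ} (x y : ι → ℝ) (hy : ∀ j, |β * y j| ≤ 1)
    {u : ι → ℝ} (hu : ∀ j, 0 ≤ u j) :
    gibbsMean β (x + y) u ≤ Real.exp 2 * gibbsMean β x u := by
  unfold gibbsMean
  rw [Finset.mul_sum]
  refine Finset.sum_le_sum fun j _ => ?_
  rw [← mul_assoc]
  exact mul_le_mul_of_nonneg_right (gibbs_add_le x y hy j) (hu j)

lemma le_smoothMax [Nonempty ι] {β : ℝ} (hβ : 0 < β) (x : ι → ℝ) : ⨆ j, x j ≤ smoothMax β x := by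
  refine ciSup_le fun j => ?_
  have h : β * x j ≤ Real.log (∑ k, Real.exp (β * x k)) := by
    rw [Real.le_log_iff_exp_le (sum_exp_pos β x)]
    exact Finset.single_le_sum (f := fun k => Real.exp (β * x k))
      (fun k _ => (Real.exp_pos _).le) (Finset.mem_univ j)
  calc x j = β⁻¹ * (β * x j) := by field_simp
    _ ≤ _ := by unfold smoothMax; gcongr

/-- Every exponential is at most the largest one. Together with `le_smoothMax` this makes the
smoothing error one-sided, which the asymmetric cutoffs below exploit. -/
lemma smoothMax_le [Nonempty ι] {β : ℝ} (hβ : 0 < β) (x : ι → ℝ) :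
    smoothMax β x ≤ (⨆ j, x j) + β⁻¹ * Real.log (Fintype.card ι) := by
  have hc : (0 : ℝ) < Fintype.card ι := by exact_mod_cast Fintype.card_pos
  have h : Real.log (∑ k, Real.exp (β * x k)) ≤ Real.log (Fintype.card ι) + β * ⨆ j, x j := by
    rw [Real.log_le_iff_le_exp (sum_exp_pos β x), Real.exp_add, Real.exp_log hc]
    calc ∑ k, Real.exp (β * x k) ≤ ∑ _k : ι, Real.exp (β * ⨆ j, x j) := by
          refine Finset.sum_le_sum fun k _ => Real.exp_le_exp.mpr ?_
          gcongr
          exact le_ciSup (Set.finite_range x).bddAbove k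
      _ = _ := by simp
  calc smoothMax β x ≤ β⁻¹ * (Real.log (Fintype.card ι) + β * ⨆ j, x j) := by
        unfold smoothMax; gcongr
    _ = _ := by field_simp; ring

lemma continuous_gibbs [Nonempty ι] (β : ℝ) (j : ι) :
    Continuous fun x : ι → ℝ => gibbs β x j := by
  unfold gibbs
  exact Continuous.div (by fun_prop) (by fun_prop) fun x => (sum_exp_pos β x).ne'

lemma continuous_smoothMax [Nonempty ι] (β : ℝ) : Continuous fun x : ι → ℝ => smoothMax β x := by
  unfold smoothMax
  exact continuous_const.mul (Continuous.log (by fun_prop) fun x => (sum_exp_pos β x).ne')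

section Derivatives

variable [Nonempty ι] {β : ℝ} {x u : ℝ → ι → ℝ} {x' u' : ι → ℝ} {s : ℝ}

lemma hasDerivAt_sum_exp (hx : ∀ j, HasDerivAt (fun r => x r j) (x' j) s) :
    HasDerivAt (fun r => ∑ k, Real.exp (β * x r k))
      (β * (∑ k, Real.exp (β * x s k)) * gibbsMean β (x s) x') s := by
  have h : HasDerivAt (fun r => ∑ k, Real.exp (β * x r k))
      (∑ k, Real.exp (β * x s k) * (β * x' k)) s :=
    HasDerivAt.fun_sum fun k _ => ((hx k).const_mul β).exp
  refine h.congr_deriv ?_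
  have hS := (sum_exp_pos β (x s)).ne'
  simp only [gibbsMean, gibbs]
  rw [Finset.mul_sum]
  refine Finset.sum_congr rfl fun k _ => ?_
  field_simp

lemma hasDerivAt_smoothMax (hβ : β ≠ 0) (hx : ∀ j, HasDerivAt (fun r => x r j) (x' j) s) :
    HasDerivAt (fun r => smoothMax β (x r)) (gibbsMean β (x s) x') s := by
  have hS := (sum_exp_pos β (x s)).ne'
  have h := ((hasDerivAt_sum_exp (β := β) hx).log hS).const_mul β⁻¹
  refine h.congr_deriv ?_
  field_simp

lemma hasDerivAt_gibbs (hx : ∀ j, HasDerivAt (fun r => x r j) (x' j) s) (j : ι) :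
    HasDerivAt (fun r => gibbs β (x r) j)
      (gibbs β (x s) j * (β * (x' j - gibbsMean β (x s) x'))) s := by
  have hS := (sum_exp_pos β (x s)).ne'
  have h := (((hx j).const_mul β).exp).div (hasDerivAt_sum_exp (β := β) hx) hS
  refine h.congr_deriv ?_
  unfold gibbs
  field_simp

/-- Moving the base point changes a Gibbs mean by β times a Gibbs covariance with the direction. -/
lemma hasDerivAt_gibbsMean (hx : ∀ j, HasDerivAt (fun r => x r j) (x' j) s)
    (hu : ∀ j, HasDerivAt (fun r => u r j) (u' j) s) :
    HasDerivAt (fun r => gibbsMean β (x r) (u r))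
      (gibbsMean β (x s) u' + β * (gibbsMean β (x s) (fun j => x' j * u s j)
        - gibbsMean β (x s) x' * gibbsMean β (x s) (u s))) s := by
  have h : HasDerivAt (fun r => gibbsMean β (x r) (u r))
      (∑ j, (gibbs β (x s) j * (β * (x' j - gibbsMean β (x s) x')) * u s j
        + gibbs β (x s) j * u' j)) s :=
    HasDerivAt.fun_sum fun j _ => (hasDerivAt_gibbs hx j).mul (hu j)
  refine h.congr_deriv ?_
  rw [Finset.sum_add_distrib, add_comm]
  congr 1
  generalize gibbsMean β (x s) x' = m
  simp only [gibbsMean]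
  rw [Finset.mul_sum, ← Finset.sum_sub_distrib, Finset.mul_sum]
  exact Finset.sum_congr rfl fun j _ => by ring

end Derivatives

/-- The first derivative at `x` in direction `u` of `g ∘ smoothMax β`, where `g₁ = g'`. -/
noncomputable def dir₁ (β : ℝ) (g₁ : ℝ → ℝ) (x u : ι → ℝ) : ℝ :=
  g₁ (smoothMax β x) * gibbsMean β x u

/-- The Hessian at `x` of `g ∘ smoothMax β` contracted with the matrix `m`,
where `g₁ = g'` and `g₂ = g''`. -/
noncomputable def hess (β : ℝ) (g₁ g₂ : ℝ → ℝ) (x : ι → ℝ) (m : ι → ι → ℝ) : ℝ :=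
  (g₂ (smoothMax β x) - β * g₁ (smoothMax β x)) * gibbsMean β x (fun j => gibbsMean β x (m j))
    + β * g₁ (smoothMax β x) * gibbsMean β x (fun j => m j j)

/-- For a rank-one matrix the double Gibbs mean factors, leaving a g₂ term and β g₁ times a
covariance. This is the form in which derivatives along curves appear. -/
lemma hess_rankOne (β : ℝ) (g₁ g₂ : ℝ → ℝ) (x u v : ι → ℝ) :
    hess β g₁ g₂ x (fun j k => u j * v k) =
      g₂ (smoothMax β x) * gibbsMean β x u * gibbsMean β x v + β * g₁ (smoothMax β x) *
        (gibbsMean β x (fun j => u j * v j) - gibbsMean β x u * gibbsMean β x v) := by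
  have h : gibbsMean β x (fun j => gibbsMean β x (fun k => u j * v k))
      = gibbsMean β x v * gibbsMean β x u := by
    rw [← gibbsMean_smul]
    congr 1; funext j; rw [gibbsMean_smul, mul_comm]
  rw [hess, h]; ring

lemma hess_sub (β : ℝ) (g₁ g₂ : ℝ → ℝ) (x : ι → ℝ) (m m' : ι → ι → ℝ) :
    hess β g₁ g₂ x (fun j k => m j k - m' j k) = hess β g₁ g₂ x m - hess β g₁ g₂ x m' := by
  simp only [hess, gibbsMean_sub]; ring

lemma hess_sum {κ : Type*} (s : Finset κ) (β : ℝ) (g₁ g₂ : ℝ → ℝ) (x : ι → ℝ)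
    (m : κ → ι → ι → ℝ) :
    hess β g₁ g₂ x (fun j k => ∑ i ∈ s, m i j k) = ∑ i ∈ s, hess β g₁ g₂ x (m i) := by
  simp only [hess, gibbsMean_sum, Finset.mul_sum, Finset.sum_add_distrib]

/-- Gibbs weights are a probability vector, so the largest entry of the matrix suffices and the
dimension does not enter. -/
lemma abs_hess_le [Nonempty ι] {β : ℝ} (hβ : 0 < β) {g₁ g₂ : ℝ → ℝ} {M₁ M₂ : ℝ}
    (h₁ : ∀ t, |g₁ t| ≤ M₁) (h₂ : ∀ t, |g₂ t| ≤ M₂) (x : ι → ℝ) {m : ι → ι → ℝ} {c : ℝ}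
    (hm : ∀ j k, |m j k| ≤ c) :
    |hess β g₁ g₂ x m| ≤ (M₂ + 2 * β * M₁) * c := by
  have hM1 : 0 ≤ M₁ := (abs_nonneg _).trans (h₁ 0)
  have hM2 : 0 ≤ M₂ := (abs_nonneg _).trans (h₂ 0)
  have hc : 0 ≤ c := (abs_nonneg _).trans (hm (Classical.arbitrary ι) (Classical.arbitrary ι))
  have ha : |gibbsMean β x (fun j => gibbsMean β x (m j))| ≤ c :=
    (abs_gibbsMean_le β x _).trans (gibbsMean_le_of_le β x fun j =>
      (abs_gibbsMean_le β x _).trans (gibbsMean_le_of_le β x (hm j)))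
  have hb : |gibbsMean β x (fun j => m j j)| ≤ c :=
    (abs_gibbsMean_le β x _).trans (gibbsMean_le_of_le β x fun j => hm j j)
  have h3 : |g₂ (smoothMax β x) - β * g₁ (smoothMax β x)| ≤ M₂ + β * M₁ := by
    refine (abs_sub _ _).trans (add_le_add (h₂ _) ?_)
    rw [abs_mul, abs_of_pos hβ]; exact mul_le_mul_of_nonneg_left (h₁ _) hβ.le
  have h4 : |β * g₁ (smoothMax β x)| ≤ β * M₁ := by
    rw [abs_mul, abs_of_pos hβ]; exact mul_le_mul_of_nonneg_left (h₁ _) hβ.le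
  calc |hess β g₁ g₂ x m| ≤ (M₂ + β * M₁) * c + β * M₁ * c := by
        refine (abs_add_le _ _).trans (add_le_add ?_ ?_)
        · rw [abs_mul]; exact mul_le_mul h3 ha (abs_nonneg _) (by positivity)
        · rw [abs_mul]; exact mul_le_mul h4 hb (abs_nonneg _) (by positivity)
    _ = _ := by ring

lemma abs_dir₁_le [Nonempty ι] {β : ℝ} {g₁ : ℝ → ℝ} {M₁ : ℝ} (h₁ : ∀ t, |g₁ t| ≤ M₁)
    (x : ι → ℝ) {u : ι → ℝ} {c : ℝ} (hu : ∀ j, |u j| ≤ c) : |dir₁ β g₁ x u| ≤ M₁ * c := by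
  rw [dir₁, abs_mul]
  exact mul_le_mul (h₁ _) ((abs_gibbsMean_le β x _).trans (gibbsMean_le_of_le β x hu))
    (abs_nonneg _) ((abs_nonneg _).trans (h₁ 0))

section Derivatives

variable [Nonempty ι] {β : ℝ} {x u : ℝ → ι → ℝ} {x' u' : ι → ℝ} {s : ℝ} {g g₁ g₂ g₃ : ℝ → ℝ}

lemma hasDerivAt_comp_smoothMax (hβ : β ≠ 0) (hg : ∀ t, HasDerivAt g (g₁ t) t)
    (hx : ∀ j, HasDerivAt (fun r => x r j) (x' j) s) :
    HasDerivAt (fun r => g (smoothMax β (x r))) (dir₁ β g₁ (x s) x') s :=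
  (hg _).comp s (hasDerivAt_smoothMax hβ hx)

lemma hasDerivAt_dir₁ (hβ : β ≠ 0) (hg₁ : ∀ t, HasDerivAt g₁ (g₂ t) t)
    (hx : ∀ j, HasDerivAt (fun r => x r j) (x' j) s)
    (hu : ∀ j, HasDerivAt (fun r => u r j) (u' j) s) :
    HasDerivAt (fun r => dir₁ β g₁ (x r) (u r))
      (dir₁ β g₁ (x s) u' + hess β g₁ g₂ (x s) (fun j k => x' j * u s k)) s := by
  have h := (hasDerivAt_comp_smoothMax hβ hg₁ hx).mul (hasDerivAt_gibbsMean (β := β) hx hu)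
  refine h.congr_deriv ?_
  rw [hess_rankOne, dir₁, dir₁]; ring

/-- The third derivative of `g ∘ smoothMax β` along a line is controlled by the Gibbs mean
of the cubed direction. -/
lemma hasDerivAt_hess (hβ : 0 < β) (hg₁ : ∀ t, HasDerivAt g₁ (g₂ t) t)
    (hg₂ : ∀ t, HasDerivAt g₂ (g₃ t) t) {M₁ M₂ M₃ : ℝ}
    (h₁ : ∀ t, |g₁ t| ≤ M₁) (h₂ : ∀ t, |g₂ t| ≤ M₂) (h₃ : ∀ t, |g₃ t| ≤ M₃)
    {v : ι → ℝ} (hx : ∀ j, HasDerivAt (fun r => x r j) (v j) s) :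
    ∃ d, HasDerivAt (fun r => hess β g₁ g₂ (x r) (fun j k => v j * v k)) d s ∧
      |d| ≤ (M₃ + 3 * β * M₂ + 4 * β ^ 2 * M₁) * gibbsMean β (x s) (fun j => |v j| ^ 3) := by
  have hM1 : 0 ≤ M₁ := (abs_nonneg _).trans (h₁ 0)
  have hM2 : 0 ≤ M₂ := (abs_nonneg _).trans (h₂ 0)
  have hM3 : 0 ≤ M₃ := (abs_nonneg _).trans (h₃ 0)
  simp only [hess_rankOne]
  have hv : HasDerivAt (fun r => gibbsMean β (x r) v) _ s :=
    hasDerivAt_gibbsMean (β := β) hx (u := fun _ => v) (u' := fun _ => 0)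
      fun j => hasDerivAt_const _ _
  have hvv : HasDerivAt (fun r => gibbsMean β (x r) (fun j => v j * v j)) _ s :=
    hasDerivAt_gibbsMean (β := β) hx (u := fun _ j => v j * v j) (u' := fun _ => 0)
      fun j => hasDerivAt_const _ _
  have hG2 := hasDerivAt_comp_smoothMax (β := β) hβ.ne' hg₂ hx
  have hG1 := hasDerivAt_comp_smoothMax (β := β) hβ.ne' hg₁ hx
  refine ⟨_, ((hG2.mul hv).mul hv).add ((hG1.const_mul β).mul (hvv.sub (hv.mul hv))), ?_⟩
  simp only [gibbsMean_const, dir₁, Pi.mul_apply]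
  set F := smoothMax β (x s)
  set m := gibbsMean β (x s) v with hm
  set q := gibbsMean β (x s) (fun j => v j * v j) with hq
  set w := gibbsMean β (x s) (fun j => v j * (v j * v j)) with hw
  set A := gibbsMean β (x s) (fun j => |v j| ^ 3) with hA
  have hqm : m ^ 2 ≤ q := by
    have := sq_gibbsMean_le β (x s) v
    simpa only [sq, ← hm, ← hq] using this
  have hma : |m| ≤ gibbsMean β (x s) (fun j => |v j|) := abs_gibbsMean_le _ _ _
  have hq0 : 0 ≤ q := (sq_nonneg _).trans hqm
  have hmq : |m| * q ≤ A := by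
    have := gibbsMean_mul_sq_le β (x s) (a := fun j => |v j|) fun j => abs_nonneg _
    simp only [sq_abs] at this
    have h' : gibbsMean β (x s) (fun j => v j ^ 2) = q := by simp only [hq, sq]
    rw [h'] at this
    exact (mul_le_mul_of_nonneg_right hma hq0).trans this
  have hwA : |w| ≤ A := by
    refine (abs_gibbsMean_le _ _ _).trans (le_of_eq ?_)
    congr 1; funext j; rw [abs_mul, abs_mul]; ring
  have hm3 : |m| ^ 3 ≤ A := by
    have : |m| ^ 3 = |m| * m ^ 2 := by rw [← sq_abs m]; ring
    rw [this]
    exact (mul_le_mul_of_nonneg_left hqm (abs_nonneg _)).trans hmq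
  have hA0 : 0 ≤ A := (abs_nonneg _).trans hwA
  have hmv : |m * (q - m * m)| ≤ A := by
    rw [abs_mul, abs_of_nonneg (by linarith [sq m] : 0 ≤ q - m * m)]
    exact (mul_le_mul_of_nonneg_left (by linarith [mul_self_nonneg m] : q - m * m ≤ q)
      (abs_nonneg _)).trans hmq
  have hmq' : |m * q| ≤ A := by rw [abs_mul, abs_of_nonneg hq0]; exact hmq
  have e : ∀ a b c : ℝ, |a| ≤ c → |b| ≤ A → |a * b| ≤ c * A := fun a b c ha hb => by
    rw [abs_mul]; exact mul_le_mul ha hb (abs_nonneg _) ((abs_nonneg _).trans ha)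
  -- The derivative equals g₃ m³ + 3β g₂ m(q - m²) + β² g₁ (w - mq - 2m(q - m²)), the last bracket
  -- being the third Gibbs cumulant. Each of m³, m(q - m²), w and mq is at most A in absolute value,
  -- whence the coefficients 1, 3 and 1 + 1 + 2 = 4.
  have t1 := e (g₃ F) (m * m * m) M₃ (h₃ F) (by
    rw [abs_mul, abs_mul]; calc _ = |m| ^ 3 := by ring
      _ ≤ A := hm3)
  have t2 := e (3 * β * g₂ F) (m * (q - m * m)) (3 * β * M₂) (by
    rw [abs_mul, abs_of_pos (by positivity : 0 < 3 * β)]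
    exact mul_le_mul_of_nonneg_left (h₂ F) (by positivity)) hmv
  have hb : |β ^ 2 * g₁ F| ≤ β ^ 2 * M₁ := by
    rw [abs_mul, abs_of_pos (by positivity : 0 < β ^ 2)]
    exact mul_le_mul_of_nonneg_left (h₁ F) (by positivity)
  have t3 := e (β ^ 2 * g₁ F) w _ hb hwA
  have t4 := e (β ^ 2 * g₁ F) (m * q) _ hb hmq'
  have t5 := e (β ^ 2 * g₁ F) (m * (q - m * m)) _ hb hmv
  rw [abs_le] at *
  constructor <;> nlinarith [t1.1, t1.2, t2.1, t2.2, t3.1, t3.2, t4.1, t4.2, t5.1, t5.2]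

end Derivatives

end MaxCoupling

/-! ### Smooth cutoffs adapted to unions of grid cells. -/

namespace MaxCoupling

/-- A smooth bump supported in `[-1, 1]` whose integer translates sum to one. -/
noncomputable def unitBump (t : ℝ) : ℝ := Real.smoothTransition (t + 1) - Real.smoothTransition t

lemma unitBump_nonneg (t : ℝ) : 0 ≤ unitBump t :=
  sub_nonneg.mpr (Real.smoothTransition.monotone (by linarith))

lemma unitBump_eq_zero {t : ℝ} (h : 1 ≤ |t|) : unitBump t = 0 := by
  unfold unitBump
  rcases le_abs.mp h with h | h
  · rw [Real.smoothTransition.one_of_one_le h, Real.smoothTransition.one_of_one_le (by linarith),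
      sub_self]
  · rw [Real.smoothTransition.zero_of_nonpos (by linarith),
      Real.smoothTransition.zero_of_nonpos (by linarith), sub_self]

lemma contDiff_unitBump : ContDiff ℝ 3 unitBump :=
  (Real.smoothTransition.contDiff.comp (by fun_prop)).sub Real.smoothTransition.contDiff

lemma tsupport_unitBump_subset : tsupport unitBump ⊆ Set.Icc (-1) 1 := by
  refine closure_minimal (fun t ht => ?_) isClosed_Icc
  by_contra h
  refine ht (unitBump_eq_zero ?_)
  rw [Set.mem_Icc, ← abs_le] at h
  exact (not_le.mp h).le

lemma tsupport_iterate_deriv_unitBump_subset (r : ℕ) :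
    tsupport (deriv^[r] unitBump) ⊆ Set.Icc (-1) 1 := by
  induction r with
  | zero => exact tsupport_unitBump_subset
  | succ r ih =>
    rw [Function.iterate_succ_apply']
    exact (closure_minimal support_deriv_subset (isClosed_tsupport _)).trans ih

lemma continuous_iterate_deriv_unitBump {r : ℕ} (hr : r ≤ 3) :
    Continuous (deriv^[r] unitBump) := by
  rw [← iteratedDeriv_eq_iterate]
  exact contDiff_unitBump.continuous_iteratedDeriv r (by exact_mod_cast hr)

lemma hasDerivAt_iterate_deriv_unitBump {r : ℕ} (hr : r < 3) (t : ℝ) :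
    HasDerivAt (deriv^[r] unitBump) (deriv^[r + 1] unitBump t) t := by
  rw [Function.iterate_succ_apply', ← iteratedDeriv_eq_iterate]
  exact ((contDiff_unitBump.differentiable_iteratedDeriv r (by exact_mod_cast hr)) t).hasDerivAt

lemma exists_bound_iterate_deriv_unitBump :
    ∃ M : ℝ, 0 < M ∧ ∀ r ≤ 3, ∀ t, |deriv^[r] unitBump t| ≤ M := by
  have h : ∀ r : Fin 4, ∃ M : ℝ, ∀ t, |deriv^[(r : ℕ)] unitBump t| ≤ M := fun r =>
    (continuous_iterate_deriv_unitBump (Nat.lt_succ_iff.mp r.2)).bounded_above_of_compact_support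
      (IsCompact.of_isClosed_subset isCompact_Icc (isClosed_tsupport _)
        (tsupport_iterate_deriv_unitBump_subset r))
  choose M hM using h
  have h0 : ∀ r, 0 ≤ M r := fun r => (abs_nonneg _).trans (hM r 0)
  refine ⟨∑ r, M r + 1, by linarith [Finset.sum_nonneg fun r (_ : r ∈ Finset.univ) => h0 r],
    fun r hr t => ?_⟩
  have h1 := Finset.single_le_sum (fun r _ => h0 r) (Finset.mem_univ (⟨r, by omega⟩ : Fin 4))
  have h2 := hM ⟨r, by omega⟩ t
  simp only at h2
  linarith

/-- At most three integers lie within distance 1 of t, so the bound does not depend on T. This makes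
the cutoff constants uniform over all unions of cells. -/
lemma abs_sum_translates_le {φ : ℝ → ℝ} {M : ℝ} (hM : ∀ t, |φ t| ≤ M)
    (hφ : Function.support φ ⊆ Set.Icc (-1) 1) (T : Finset ℤ) (t : ℝ) :
    |∑ k ∈ T, φ (t - k)| ≤ 3 * M := by
  have hM0 : 0 ≤ M := (abs_nonneg _).trans (hM 0)
  have hz : ∀ k ∈ T, k ∉ T ∩ {⌊t⌋ - 1, ⌊t⌋, ⌊t⌋ + 1} → φ (t - k) = 0 := by
    intro k hk hk'
    by_contra hne
    have h := hφ hne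
    rw [Set.mem_Icc] at h
    refine hk' (Finset.mem_inter.mpr ⟨hk, ?_⟩)
    have h1 := Int.floor_le t
    have h2 := Int.lt_floor_add_one t
    have h3 : (k : ℝ) < (⌊t⌋ + 2 : ℤ) := by push_cast; linarith
    have h4 : ((⌊t⌋ - 1 : ℤ) : ℝ) ≤ k := by push_cast; linarith
    have h3' := Int.cast_lt.mp h3
    have h4' := Int.cast_le.mp h4
    simp only [Finset.mem_insert, Finset.mem_singleton]
    omega
  rw [← Finset.sum_subset Finset.inter_subset_left hz]
  calc |∑ k ∈ T ∩ {⌊t⌋ - 1, ⌊t⌋, ⌊t⌋ + 1}, φ (t - k)|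
      ≤ ∑ k ∈ T ∩ {⌊t⌋ - 1, ⌊t⌋, ⌊t⌋ + 1}, |φ (t - k)| := Finset.abs_sum_le_sum_abs _ _
    _ ≤ ∑ _k ∈ T ∩ {⌊t⌋ - 1, ⌊t⌋, ⌊t⌋ + 1}, M := Finset.sum_le_sum fun k _ => hM _
    _ = (T ∩ {⌊t⌋ - 1, ⌊t⌋, ⌊t⌋ + 1}).card * M := by simp
    _ ≤ 3 * M := by
        gcongr
        exact_mod_cast (Finset.card_le_card Finset.inter_subset_right).trans Finset.card_le_three

/-- The bump vanishes at distance 1 or more, so only the two grid points around t contribute. -/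
lemma sum_translates_unitBump (T : Finset ℤ) (t : ℝ) :
    ∑ k ∈ T, unitBump (t - k) = (if ⌊t⌋ ∈ T then unitBump (t - ⌊t⌋) else 0)
      + if ⌊t⌋ + 1 ∈ T then unitBump (t - ⌊t⌋ - 1) else 0 := by
  have h : ∀ k ∈ T, unitBump (t - k) = (if ⌊t⌋ = k then unitBump (t - ⌊t⌋) else 0)
      + if ⌊t⌋ + 1 = k then unitBump (t - ⌊t⌋ - 1) else 0 := by
    intro k _
    have h1 := Int.floor_le t
    have h2 := Int.lt_floor_add_one t
    rcases lt_trichotomy k ⌊t⌋ with hk | hk | hk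
    · rw [if_neg (by omega), if_neg (by omega), add_zero]
      have : (k : ℝ) ≤ (⌊t⌋ - 1 : ℤ) := Int.cast_le.mpr (by omega)
      push_cast at this
      exact unitBump_eq_zero (le_abs.mpr (Or.inl (by linarith)))
    · subst hk; simp
    · rcases eq_or_ne k (⌊t⌋ + 1) with rfl | hk'
      · rw [if_neg (by omega), if_pos rfl, zero_add, sub_sub]; push_cast; rfl
      · rw [if_neg (by omega), if_neg (by omega), add_zero]
        have : ((⌊t⌋ + 2 : ℤ) : ℝ) ≤ k := Int.cast_le.mpr (by omega)
        push_cast at this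
        exact unitBump_eq_zero (le_abs.mpr (Or.inr (by linarith)))
  rw [Finset.sum_congr rfl h, Finset.sum_add_distrib]
  simp

/-- The two differences of transition functions telescope. -/
lemma unitBump_fract_add (t : ℝ) : unitBump (t - ⌊t⌋) + unitBump (t - ⌊t⌋ - 1) = 1 := by
  have h1 := Int.floor_le t
  have h2 := Int.lt_floor_add_one t
  unfold unitBump
  rw [Real.smoothTransition.one_of_one_le (by linarith : 1 ≤ t - ⌊t⌋ + 1),
    Real.smoothTransition.zero_of_nonpos (by linarith : t - ⌊t⌋ - 1 ≤ 0)]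
  simp

/-- A smooth cutoff at scale `δ` equal to one on the grid cells indexed by `S` and their right
neighbours, vanishing away from them, with derivative bounds independent of `S`. -/
theorem exists_smooth_cutoff : ∃ M : ℝ, 0 < M ∧ ∀ (S : Finset ℤ) (δ : ℝ), 0 < δ →
    ∃ g g₁ g₂ g₃ : ℝ → ℝ, (∀ t, HasDerivAt g (g₁ t) t) ∧ (∀ t, HasDerivAt g₁ (g₂ t) t) ∧
      (∀ t, HasDerivAt g₂ (g₃ t) t) ∧ (∀ t, |g₁ t| ≤ M * δ⁻¹) ∧ (∀ t, |g₂ t| ≤ M * δ⁻¹ ^ 2) ∧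
      (∀ t, |g₃ t| ≤ M * δ⁻¹ ^ 3) ∧ (∀ t, 0 ≤ g t) ∧ (∀ t, g t ≤ 1) ∧
      (∀ k ∈ S, ∀ t, k * δ ≤ t → t < (k + 2) * δ → g t = 1) ∧
      (∀ t, g t ≠ 0 → ∃ k ∈ S, (k - 1) * δ < t ∧ t < (k + 3) * δ) := by
  obtain ⟨M, hM0, hM⟩ := exists_bound_iterate_deriv_unitBump
  refine ⟨3 * M, by positivity, fun S δ hδ => ?_⟩
  -- Bumps are centered at grid points. For the sum to be one on both cells k and k + 1, all their
  -- endpoints k, k + 1, k + 2 must carry a bump; the right neighbour is included because the soft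
  -- maximum may overshoot by one mesh.
  set T : Finset ℤ := S ∪ S.image (· + 1) ∪ S.image (· + 2) with hT
  let G : ℕ → ℝ → ℝ := fun r t => ∑ k ∈ T, deriv^[r] unitBump (δ⁻¹ * t - k) * δ⁻¹ ^ r
  have hG : ∀ r < 3, ∀ t, HasDerivAt (G r) (G (r + 1) t) t := by
    intro r hr t
    refine HasDerivAt.fun_sum fun k _ => ?_
    have h1 : HasDerivAt (fun t => δ⁻¹ * t - (k : ℝ)) δ⁻¹ t := by
      simpa using ((hasDerivAt_id t).const_mul δ⁻¹).sub_const (k : ℝ)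
    refine (((hasDerivAt_iterate_deriv_unitBump hr _).comp t h1).mul_const (δ⁻¹ ^ r)).congr_deriv ?_
    ring
  have hb : ∀ r ≤ 3, ∀ t, |G r t| ≤ 3 * M * δ⁻¹ ^ r := by
    intro r hr t
    simp only [G]
    rw [← Finset.sum_mul, abs_mul, abs_of_pos (by positivity : 0 < δ⁻¹ ^ r)]
    gcongr
    exact abs_sum_translates_le (hM r hr)
      ((subset_tsupport _).trans (tsupport_iterate_deriv_unitBump_subset r)) T _
  have hG0 : ∀ t, G 0 t = ∑ k ∈ T, unitBump (δ⁻¹ * t - k) := by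
    intro t; simp [G]
  refine ⟨G 0, G 1, G 2, G 3, hG 0 (by norm_num), hG 1 (by norm_num), hG 2 (by norm_num),
    fun t => by simpa using hb 1 (by norm_num) t, hb 2 (by norm_num), hb 3 le_rfl, fun t => ?_, fun t => ?_,
    fun k hk t h1 h2 => ?_, fun t ht => ?_⟩
  · rw [hG0]; exact Finset.sum_nonneg fun k _ => unitBump_nonneg _
  · rw [hG0, sum_translates_unitBump]
    refine le_trans ?_ (unitBump_fract_add (δ⁻¹ * t)).le
    refine add_le_add ?_ ?_
    · split_ifs <;> first | exact le_rfl | exact unitBump_nonneg _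
    · split_ifs <;> first | exact le_rfl | exact unitBump_nonneg _
  · have h1' : (k : ℝ) ≤ δ⁻¹ * t := by rw [inv_mul_eq_div, le_div_iff₀ hδ]; exact h1
    have h2' : δ⁻¹ * t < ((k + 2 : ℤ) : ℝ) := by
      rw [inv_mul_eq_div, div_lt_iff₀ hδ]; push_cast; exact h2
    have h3 : k ≤ ⌊δ⁻¹ * t⌋ := Int.le_floor.mpr h1'
    have h4 : ⌊δ⁻¹ * t⌋ < k + 2 := Int.floor_lt.mpr h2'
    have h5 : ⌊δ⁻¹ * t⌋ ∈ T ∧ ⌊δ⁻¹ * t⌋ + 1 ∈ T := by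
      rcases (show ⌊δ⁻¹ * t⌋ = k ∨ ⌊δ⁻¹ * t⌋ = k + 1 by omega) with h | h
      · rw [h]; simp [hT, hk]
      · rw [h]
        refine ⟨by simp [hT, hk], ?_⟩
        rw [show k + 1 + 1 = k + 2 by ring]; simp [hT, hk]
    rw [hG0, sum_translates_unitBump, if_pos h5.1, if_pos h5.2, unitBump_fract_add]
  · rw [hG0] at ht
    obtain ⟨m, hm, hne⟩ := Finset.exists_ne_zero_of_sum_ne_zero ht
    have h1 : |δ⁻¹ * t - m| < 1 := by
      by_contra h
      exact hne (unitBump_eq_zero (not_lt.mp h))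
    rw [inv_mul_eq_div, abs_lt] at h1
    have h2 : ((m : ℝ) - 1) * δ < t := by rw [← lt_div_iff₀ hδ]; linarith
    have h3 : t < ((m : ℝ) + 1) * δ := by rw [← div_lt_iff₀ hδ]; linarith
    simp only [hT, Finset.mem_union, Finset.mem_image] at hm
    rcases hm with (hm | ⟨k, hk, rfl⟩) | ⟨k, hk, rfl⟩
    · exact ⟨m, hm, h2, h3.trans (by nlinarith)⟩
    · refine ⟨k, hk, ?_, ?_⟩ <;> push_cast at h2 h3 <;> nlinarith
    · refine ⟨k, hk, ?_, ?_⟩ <;> push_cast at h2 h3 <;> nlinarith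

end MaxCoupling

/-! ### Test functions with bounded derivatives: regularity and integration. -/

namespace MaxCoupling

variable {ι : Type*} [Fintype ι]

/-- `g₁, g₂, g₃` are the successive derivatives of `g`, bounded by `M₁, M₂, M₃`. -/
structure BoundedDerivs (g g₁ g₂ g₃ : ℝ → ℝ) (M₁ M₂ M₃ : ℝ) : Prop where
  hasDeriv : ∀ t, HasDerivAt g (g₁ t) t
  hasDeriv₁ : ∀ t, HasDerivAt g₁ (g₂ t) t
  hasDeriv₂ : ∀ t, HasDerivAt g₂ (g₃ t) t
  bound₁ : ∀ t, |g₁ t| ≤ M₁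
  bound₂ : ∀ t, |g₂ t| ≤ M₂
  bound₃ : ∀ t, |g₃ t| ≤ M₃

namespace BoundedDerivs

variable {g g₁ g₂ g₃ : ℝ → ℝ} {M₁ M₂ M₃ : ℝ} (h : BoundedDerivs g g₁ g₂ g₃ M₁ M₂ M₃)
include h

lemma continuous : Continuous g := continuous_iff_continuousAt.mpr fun t =>
  (h.hasDeriv t).continuousAt

lemma continuous₁ : Continuous g₁ := continuous_iff_continuousAt.mpr fun t =>
  (h.hasDeriv₁ t).continuousAt

lemma continuous₂ : Continuous g₂ := continuous_iff_continuousAt.mpr fun t =>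
  (h.hasDeriv₂ t).continuousAt

lemma nonneg₁ : 0 ≤ M₁ := (abs_nonneg _).trans (h.bound₁ 0)

lemma nonneg₂ : 0 ≤ M₂ := (abs_nonneg _).trans (h.bound₂ 0)

lemma nonneg₃ : 0 ≤ M₃ := (abs_nonneg _).trans (h.bound₃ 0)

end BoundedDerivs

section Regularity

variable [Nonempty ι] {α : Type*} [TopologicalSpace α]

lemma Continuous.gibbsMean {β : ℝ} {x u : α → ι → ℝ} (hx : Continuous x) (hu : Continuous u) :
    Continuous fun a => gibbsMean β (x a) (u a) := by
  unfold MaxCoupling.gibbsMean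
  refine continuous_finsetSum _ fun j _ => ?_
  exact ((continuous_gibbs β j).comp hx).mul ((continuous_apply j).comp hu)

lemma Continuous.dir₁ {β : ℝ} {g₁ : ℝ → ℝ} (hg : Continuous g₁) {x u : α → ι → ℝ}
    (hx : Continuous x) (hu : Continuous u) : Continuous fun a => dir₁ β g₁ (x a) (u a) :=
  (hg.comp ((continuous_smoothMax β).comp hx)).mul (Continuous.gibbsMean hx hu)

lemma Continuous.hess {β : ℝ} {g₁ g₂ : ℝ → ℝ} (hg₁ : Continuous g₁) (hg₂ : Continuous g₂)
    {x : α → ι → ℝ} {m : α → ι → ι → ℝ} (hx : Continuous x) (hm : Continuous m) :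
    Continuous fun a => hess β g₁ g₂ (x a) (m a) := by
  have hF := (continuous_smoothMax β).comp hx
  have h1 : Continuous fun a => MaxCoupling.gibbsMean β (x a)
      (fun j => MaxCoupling.gibbsMean β (x a) (m a j)) :=
    Continuous.gibbsMean hx (continuous_pi fun j => Continuous.gibbsMean hx (by fun_prop))
  have h2 : Continuous fun a => MaxCoupling.gibbsMean β (x a) (fun j => m a j j) :=
    Continuous.gibbsMean hx (by fun_prop)
  exact (((hg₂.comp hF).sub (continuous_const.mul (hg₁.comp hF))).mul h1).add
    ((continuous_const.mul (hg₁.comp hF)).mul h2)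

end Regularity

lemma integral_gibbsMean {α : Type*} [MeasurableSpace α] {ν : Measure α} (β : ℝ) (x : ι → ℝ)
    {u : α → ι → ℝ} (hu : ∀ j, Integrable (fun a => u a j) ν) :
    ∫ a, gibbsMean β x (u a) ∂ν = gibbsMean β x (fun j => ∫ a, u a j ∂ν) := by
  unfold gibbsMean
  rw [integral_finsetSum _ fun j _ => (hu j).const_mul _]
  exact Finset.sum_congr rfl fun j _ => integral_const_mul _ _

lemma integrable_gibbsMean {α : Type*} [MeasurableSpace α] {ν : Measure α} (β : ℝ) (x : ι → ℝ)
    {u : α → ι → ℝ} (hu : ∀ j, Integrable (fun a => u a j) ν) :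
    Integrable (fun a => gibbsMean β x (u a)) ν :=
  integrable_finsetSum _ fun j _ => (hu j).const_mul _

lemma integral_hess {α : Type*} [MeasurableSpace α] {ν : Measure α} (β : ℝ) (g₁ g₂ : ℝ → ℝ)
    (x : ι → ℝ) {m : α → ι → ι → ℝ} (hm : ∀ j k, Integrable (fun a => m a j k) ν) :
    ∫ a, hess β g₁ g₂ x (m a) ∂ν = hess β g₁ g₂ x (fun j k => ∫ a, m a j k ∂ν) := by
  have h1 : ∀ j, Integrable (fun a => gibbsMean β x (m a j)) ν :=
    fun j => integrable_gibbsMean β x (hm j)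
  unfold hess
  rw [integral_add ((integrable_gibbsMean β x h1).const_mul _)
    ((integrable_gibbsMean β x fun j => hm j j).const_mul _), integral_const_mul,
    integral_const_mul, integral_gibbsMean β x h1, integral_gibbsMean β x fun j => hm j j]
  simp only [integral_gibbsMean β x (hm _)]

/-! ### Taylor expansion along a single summand. -/

section Taylor

variable [Nonempty ι] {g g₁ g₂ g₃ : ℝ → ℝ} {M₁ M₂ M₃ β : ℝ}

/-- The coefficient of the third order remainder. -/
def thirdCoeff (β M₁ M₂ M₃ : ℝ) : ℝ := M₃ + 3 * β * M₂ + 4 * β ^ 2 * M₁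

/-- Second order expansion of the first derivative, with a remainder controlled by the Gibbs mean
at the base point unless the increment is large. -/
lemma abs_dir₁_sub_sub_hess_le (h : BoundedDerivs g g₁ g₂ g₃ M₁ M₂ M₃) (hβ : 0 < β)
    (w v : ι → ℝ) {a T : ℝ} (ha0 : 0 ≤ a) (ha1 : a ≤ 1) (hT0 : 0 ≤ T)
    (hT : (∃ j, 1 < |β * v j|) → ∀ j, |v j| ^ 3 ≤ T) :
    |dir₁ β g₁ w v - dir₁ β g₁ (w - a • v) v - a * hess β g₁ g₂ w (fun j k => v j * v k)|
      ≤ thirdCoeff β M₁ M₂ M₃ * (Real.exp 2 * gibbsMean β w (fun j => |v j| ^ 3) + T) := by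
  have := h.nonneg₁
  have := h.nonneg₂
  have := h.nonneg₃
  have hK : 0 ≤ thirdCoeff β M₁ M₂ M₃ := by unfold thirdCoeff; positivity
  have hA0 : 0 ≤ gibbsMean β w (fun j => |v j| ^ 3) := gibbsMean_nonneg _ _ fun j => by positivity
  set B := thirdCoeff β M₁ M₂ M₃ * (Real.exp 2 * gibbsMean β w (fun j => |v j| ^ 3) + T) with hB
  have hB0 : 0 ≤ B := by positivity
  -- If the increment is small on the scale 1/β, the Gibbs weights change by at most a factor e²
  -- along the segment; otherwise T dominates every cube.
  have hG : ∀ s ∈ Set.Icc (0 : ℝ) 1, gibbsMean β (w - s • v) (fun j => |v j| ^ 3)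
      ≤ Real.exp 2 * gibbsMean β w (fun j => |v j| ^ 3) + T := by
    intro s hs
    by_cases hv : ∃ j, 1 < |β * v j|
    · exact (gibbsMean_le_of_le _ _ (hT hv)).trans (le_add_of_nonneg_left (by positivity))
    · push Not at hv
      refine le_add_of_le_of_nonneg ?_ hT0
      rw [sub_eq_add_neg]
      refine gibbsMean_add_le w (-(s • v)) (fun j => ?_) fun j => by positivity
      have : β * (-(s • v)) j = -(s * (β * v j)) := by simp; ring
      rw [this, abs_neg, abs_mul, abs_of_nonneg hs.1]
      exact mul_le_one₀ hs.2 (abs_nonneg _) (hv j)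
  have hline : ∀ (s : ℝ) j, HasDerivAt (fun r => (w - r • v) j) ((fun k => -v k) j) s := by
    intro s j
    simpa using ((hasDerivAt_id s).mul_const (v j)).const_sub (w j)
  have hq1 : ∀ s : ℝ, HasDerivAt (fun r => dir₁ β g₁ (w - r • v) v)
      (-hess β g₁ g₂ (w - s • v) (fun j k => v j * v k)) s := by
    intro s
    refine (hasDerivAt_dir₁ hβ.ne' h.hasDeriv₁ (hline s)
      (u := fun _ => v) (u' := fun _ => 0) fun j => hasDerivAt_const _ _).congr_deriv ?_
    have e1 : dir₁ β g₁ (w - s • v) (fun _ => 0) = 0 := by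
      rw [dir₁, gibbsMean_const, mul_zero]
    have e2 := hess_rankOne β g₁ g₂ (w - s • v) (fun k => -1 * v k) v
    have e3 := hess_rankOne β g₁ g₂ (w - s • v) v v
    simp only [mul_assoc (-1 : ℝ), gibbsMean_smul] at e2
    simp only [neg_one_mul] at e2
    rw [e1]
    simp only [neg_mul]
    rw [e2, e3]; ring
  have hq2 : ∀ s : ℝ, ∃ d, HasDerivAt (fun r => hess β g₁ g₂ (w - r • v) (fun j k => v j * v k)) d s ∧
      |d| ≤ thirdCoeff β M₁ M₂ M₃ * gibbsMean β (w - s • v) (fun j => |v j| ^ 3) := by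
    intro s
    have := hasDerivAt_hess hβ h.hasDeriv₁ h.hasDeriv₂ h.bound₁ h.bound₂ h.bound₃ (hline s)
    simpa only [neg_mul_neg, abs_neg, thirdCoeff] using this
  choose d hd hdb using hq2
  have hstep : ∀ s ∈ Set.Icc (0 : ℝ) 1, |hess β g₁ g₂ (w - s • v) (fun j k => v j * v k)
      - hess β g₁ g₂ w (fun j k => v j * v k)| ≤ B := by
    intro s hs
    have h1 := norm_image_sub_le_of_norm_deriv_le_segment' (a := 0) (b := 1) (C := B)
      (fun x _ => (hd x).hasDerivWithinAt)
      (fun x hx => (hdb x).trans (mul_le_mul_of_nonneg_left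
        (hG x (Set.Ico_subset_Icc_self hx)) hK)) s hs
    simp only [zero_smul, sub_zero, Real.norm_eq_abs] at h1
    exact h1.trans (mul_le_of_le_one_right hB0 hs.2)
  -- The mean value inequality is applied a second time, now to the first derivative corrected by
  -- its linear part; the derivative of this function is the Hessian difference bounded in `hstep`.
  have h2 := norm_image_sub_le_of_norm_deriv_le_segment' (a := 0) (b := 1) (C := B)
    (f := fun r => dir₁ β g₁ (w - r • v) v + r * hess β g₁ g₂ w (fun j k => v j * v k))
    (fun x _ => ((hq1 x).add ((hasDerivAt_id x).mul_const _)).hasDerivWithinAt)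
    (fun x hx => by
      have := hstep x (Set.Ico_subset_Icc_self hx)
      rw [abs_sub_comm] at this
      rw [Real.norm_eq_abs]
      convert this using 2
      ring) a ⟨ha0, ha1⟩
  simp only [zero_smul, sub_zero, zero_mul, add_zero, Real.norm_eq_abs] at h2
  rw [abs_sub_comm] at h2
  calc _ = _ := by congr 1; ring
    _ ≤ B * a := h2
    _ ≤ B := mul_le_of_le_one_right hB0 ha1

end Taylor

/-! ### Gaussian integration by parts. -/

section Gaussian

variable [Nonempty ι] {g g₁ g₂ g₃ : ℝ → ℝ} {M₁ M₂ M₃ β : ℝ}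

/-- Gaussian integration by parts, deduced from the rotation invariance of `γ ⊗ γ`. -/
lemma integral_dir₁_gaussian (h : BoundedDerivs g g₁ g₂ g₃ M₁ M₂ M₃) (hβ : 0 < β)
    (γ : Measure (ι → ℝ)) [IsGaussian γ] (hγ : ∫ x, x ∂γ = 0) (a : ι → ℝ) (c : ℝ) :
    ∫ x, dir₁ β g₁ (a + c • x) x ∂γ
      = c * ∫ x, hess β g₁ g₂ (a + c • x) (fun j k => ∫ y, y j * y k ∂γ) ∂γ := by
  have := h.nonneg₁
  have := h.nonneg₂
  have hc₁ := h.continuous₁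
  have hc₂ := h.continuous₂
  have hint1 : Integrable (fun x : ι → ℝ => ‖x‖) γ := IsGaussian.integrable_id.norm
  have hint2 : Integrable (fun x : ι → ℝ => ‖x‖ ^ 2) γ := by
    have := (IsGaussian.memLp_two_id (μ := γ)).integrable_norm_pow (by norm_num)
    simpa using this
  have hjk : ∀ j k, Integrable (fun y : ι → ℝ => y j * y k) γ := by
    intro j k
    refine hint2.mono' (by fun_prop) (.of_forall fun y => ?_)
    rw [norm_mul, sq]
    exact mul_le_mul (norm_le_pi_norm y j) (norm_le_pi_norm y k) (norm_nonneg _) (norm_nonneg _)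
  -- Under γ ⊗ γ the mean of ψ composed with the rotation by s is constant in s. Its derivative at s
  -- = 0, computed under the integral, is the desired identity once the second variable is averaged
  -- out.
  let ψ : (ι → ℝ) × (ι → ℝ) → ℝ := fun z => dir₁ β g₁ (a + c • z.1) z.2
  have hψ : Continuous ψ := Continuous.dir₁ hc₁ (by fun_prop) (by fun_prop)
  have hrot : ∀ s, ∫ z, ψ (ContinuousLinearMap.rotation s z) ∂(γ.prod γ)
      = ∫ z, ψ z ∂(γ.prod γ) := by
    intro s
    conv_rhs => rw [← IsGaussian.map_rotation_eq_self (μ := γ) (by simpa using hγ) s]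
    rw [integral_map (by fun_prop) hψ.aestronglyMeasurable]
  let w : ℝ → (ι → ℝ) × (ι → ℝ) → ι → ℝ := fun s z =>
    a + c • (Real.cos s • z.1 + Real.sin s • z.2)
  let v : ℝ → (ι → ℝ) × (ι → ℝ) → ι → ℝ := fun s z => -Real.sin s • z.1 + Real.cos s • z.2
  let v' : ℝ → (ι → ℝ) × (ι → ℝ) → ι → ℝ := fun s z => -Real.cos s • z.1 + -Real.sin s • z.2
  let F' : ℝ → (ι → ℝ) × (ι → ℝ) → ℝ := fun s z =>
    dir₁ β g₁ (w s z) (v' s z) + hess β g₁ g₂ (w s z) (fun j k => (c * v s z j) * v s z k)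
  have hwc : ∀ s, Continuous (w s) := fun s => by fun_prop
  have hvc : ∀ s, Continuous (v s) := fun s => by fun_prop
  have hv'c : ∀ s, Continuous (v' s) := fun s => by fun_prop
  have hvb : ∀ s z j, |v s z j| ≤ ‖z.1‖ + ‖z.2‖ := by
    intro s z j
    refine (abs_add_le _ _).trans (add_le_add ?_ ?_)
    · simp only [Pi.smul_apply, smul_eq_mul, abs_mul, abs_neg]
      exact (mul_le_of_le_one_left (abs_nonneg _) (Real.abs_sin_le_one s)).trans
        (norm_le_pi_norm z.1 j)
    · simp only [Pi.smul_apply, smul_eq_mul, abs_mul]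
      exact (mul_le_of_le_one_left (abs_nonneg _) (Real.abs_cos_le_one s)).trans
        (norm_le_pi_norm z.2 j)
  have hv'b : ∀ s z j, |v' s z j| ≤ ‖z.1‖ + ‖z.2‖ := by
    intro s z j
    refine (abs_add_le _ _).trans (add_le_add ?_ ?_)
    · simp only [Pi.smul_apply, smul_eq_mul, abs_mul, abs_neg]
      exact (mul_le_of_le_one_left (abs_nonneg _) (Real.abs_cos_le_one s)).trans
        (norm_le_pi_norm z.1 j)
    · simp only [Pi.smul_apply, smul_eq_mul, abs_mul, abs_neg]
      exact (mul_le_of_le_one_left (abs_nonneg _) (Real.abs_sin_le_one s)).trans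
        (norm_le_pi_norm z.2 j)
  have hF'c : ∀ s, Continuous (F' s) := fun s =>
    (Continuous.dir₁ hc₁ (hwc s) (hv'c s)).add (Continuous.hess hc₁ hc₂ (hwc s)
      (continuous_pi fun j => continuous_pi fun k =>
        (continuous_const.mul ((continuous_apply j).comp (hvc s))).mul
          ((continuous_apply k).comp (hvc s))))
  have hb1 : Integrable (fun z : (ι → ℝ) × (ι → ℝ) => ‖z.1‖ + ‖z.2‖) (γ.prod γ) :=
    (hint1.comp_fst γ).add (hint1.comp_snd γ)
  have hb2 : Integrable (fun z : (ι → ℝ) × (ι → ℝ) => (‖z.1‖ + ‖z.2‖) ^ 2) (γ.prod γ) := by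
    refine (((hint2.comp_fst γ).add (hint2.comp_snd γ)).const_mul 2).mono'
      (by fun_prop) (.of_forall fun z => ?_)
    rw [Real.norm_of_nonneg (by positivity)]
    simp only [Pi.add_apply]
    nlinarith [sq_nonneg (‖z.1‖ - ‖z.2‖)]
  have hderiv := (hasDerivAt_integral_of_dominated_loc_of_deriv_le (μ := γ.prod γ)
    (F := fun s z => ψ (ContinuousLinearMap.rotation s z)) (F' := F') (x₀ := 0)
    (s := Set.univ) (bound := fun z => M₁ * (‖z.1‖ + ‖z.2‖)
      + (M₂ + 2 * β * M₁) * (|c| * (‖z.1‖ + ‖z.2‖) ^ 2)) Filter.univ_mem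
    (.of_forall fun s => (hψ.comp (by fun_prop)).aestronglyMeasurable)
    ((hb1.const_mul M₁).mono' (hψ.comp (by fun_prop)).aestronglyMeasurable
      (.of_forall fun z => abs_dir₁_le h.bound₁ _ (hvb 0 z)))
    (hF'c 0).aestronglyMeasurable
    (.of_forall fun z s _ => (abs_add_le _ _).trans (add_le_add
      (abs_dir₁_le h.bound₁ _ (hv'b s z)) (abs_hess_le hβ h.bound₁ h.bound₂ _ fun j k => by
        rw [mul_assoc, abs_mul, abs_mul, sq]
        exact mul_le_mul_of_nonneg_left (mul_le_mul (hvb s z j) (hvb s z k) (abs_nonneg _)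
          (by positivity)) (abs_nonneg _))))
    ((hb1.const_mul _).add ((hb2.const_mul _).const_mul _))
    (.of_forall fun z s _ => by
      refine hasDerivAt_dir₁ hβ.ne' h.hasDeriv₁ (fun j => ?_) (fun j => ?_)
      · exact ((((Real.hasDerivAt_cos s).mul_const (z.1 j)).add
          ((Real.hasDerivAt_sin s).mul_const (z.2 j))).const_mul c).const_add (a j)
      · exact ((Real.hasDerivAt_sin s).neg.mul_const (z.1 j)).add
          ((Real.hasDerivAt_cos s).mul_const (z.2 j)))).2
  have hzero : ∫ z, F' 0 z ∂(γ.prod γ) = 0 := by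
    refine hderiv.unique ?_
    simp only [hrot]
    exact hasDerivAt_const _ _
  have hF0 : F' 0 = fun z => -dir₁ β g₁ (a + c • z.1) z.1
      + c * hess β g₁ g₂ (a + c • z.1) (fun j k => z.2 j * z.2 k) := by
    funext z
    have e0 : w 0 z = a + c • z.1 := by simp [w]
    have e1 : v' 0 z = fun j => -1 * z.1 j := by funext j; simp [v']
    have e2 : v 0 z = z.2 := by simp [v]
    have e3 := hess_rankOne β g₁ g₂ (a + c • z.1) (fun j => c * z.2 j) z.2
    have e4 := hess_rankOne β g₁ g₂ (a + c • z.1) z.2 z.2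
    simp only [mul_assoc c, gibbsMean_smul] at e3
    simp only [F', e0, e1, e2, dir₁, gibbsMean_smul, mul_assoc c]
    rw [e3, e4]; ring
  have hi1 : Integrable (fun x => dir₁ β g₁ (a + c • x) x) γ :=
    (hint1.const_mul M₁).mono'
      (Continuous.dir₁ hc₁ (by fun_prop) continuous_id).aestronglyMeasurable
      (.of_forall fun x => abs_dir₁_le h.bound₁ _ (norm_le_pi_norm x))
  have hi2 : Integrable (fun z : (ι → ℝ) × (ι → ℝ) =>
      hess β g₁ g₂ (a + c • z.1) (fun j k => z.2 j * z.2 k)) (γ.prod γ) := by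
    refine ((hint2.comp_snd γ).const_mul (M₂ + 2 * β * M₁)).mono'
      (Continuous.hess hc₁ hc₂ (by fun_prop) (by fun_prop)).aestronglyMeasurable
      (.of_forall fun z => abs_hess_le hβ h.bound₁ h.bound₂ _ fun j k => ?_)
    rw [abs_mul, sq]
    exact mul_le_mul (norm_le_pi_norm z.2 j) (norm_le_pi_norm z.2 k) (abs_nonneg _) (norm_nonneg _)
  have hi3 : Integrable (fun z : (ι → ℝ) × (ι → ℝ) => -dir₁ β g₁ (a + c • z.1) z.1) (γ.prod γ) :=
    (hi1.comp_fst γ).neg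
  rw [hF0, integral_add hi3 (hi2.const_mul c), integral_neg,
    integral_const_mul, integral_prod _ hi2,
    integral_fun_fst (fun x => dir₁ β g₁ (a + c • x) x)] at hzero
  simp only [integral_hess β g₁ g₂ _ hjk, probReal_univ, one_smul] at hzero
  linarith

end Gaussian

end MaxCoupling

/-! ### Comparison with the Gaussian by trigonometric interpolation. -/

namespace MaxCoupling

variable {ι : Type*} [Fintype ι] [Nonempty ι] {κ : Type*} [Fintype κ]
  {Ω : Type*} [MeasurableSpace Ω] {g g₁ g₂ g₃ : ℝ → ℝ} {M₁ M₂ M₃ β : ℝ}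

/-- The leave-one-out first order term vanishes by independence and centering. -/
lemma integral_dir₁_leaveOut (h : BoundedDerivs g g₁ g₂ g₃ M₁ M₂ M₃)
    {μ : Measure Ω} [IsProbabilityMeasure μ] {R V : Ω → ι → ℝ} (hR : Measurable R)
    (hV : Measurable V) (hRV : IndepFun R V μ) (hVi : ∀ j, Integrable (fun ω => V ω j) μ)
    (hV0 : ∀ j, ∫ ω, V ω j ∂μ = 0) (a : ℝ) (t : ι → ℝ) :
    ∫ ω, dir₁ β g₁ (a • R ω + t) (V ω) ∂μ = 0 := by
  let φ : ι → (ι → ℝ) → ℝ := fun j r => g₁ (smoothMax β (a • r + t)) * gibbs β (a • r + t) j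
  have hφc : ∀ j, Continuous (φ j) := fun j =>
    (h.continuous₁.comp ((continuous_smoothMax β).comp (by fun_prop))).mul
      ((continuous_gibbs β j).comp (by fun_prop))
  have hφb : ∀ j r, ‖φ j r‖ ≤ M₁ := by
    intro j r
    have h1 : gibbs β (a • r + t) j ≤ 1 := by
      rw [← sum_gibbs β (a • r + t)]
      exact Finset.single_le_sum (fun k _ => gibbs_nonneg β _ k) (Finset.mem_univ j)
    rw [Real.norm_eq_abs, abs_mul, abs_of_nonneg (gibbs_nonneg _ _ _)]
    exact (mul_le_of_le_one_right (abs_nonneg _) h1).trans (h.bound₁ _)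
  have e : ∀ ω, dir₁ β g₁ (a • R ω + t) (V ω) = ∑ j, φ j (R ω) * V ω j := by
    intro ω
    simp only [dir₁, gibbsMean, Finset.mul_sum, φ, mul_assoc]
  simp only [e]
  have hi : ∀ j, Integrable (fun ω => φ j (R ω) * V ω j) μ := fun j =>
    (hVi j).bdd_mul (c := M₁) ((hφc j).measurable.comp hR).aestronglyMeasurable
      (.of_forall fun ω => hφb j (R ω))
  rw [integral_finsetSum _ fun j _ => hi j]
  refine Finset.sum_eq_zero fun j _ => ?_
  have := hRV.integral_fun_comp_mul_comp (f := φ j) (g := fun v => v j) hR.aemeasurable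
    hV.aemeasurable (hφc j).aestronglyMeasurable (measurable_pi_apply j).aestronglyMeasurable
  rw [this, hV0, mul_zero]

/-- Comparison of smooth functions of the soft maximum of a sum of independent centered vectors
with those of a centered Gaussian vector of the same covariance. -/
theorem abs_integral_comp_smoothMax_sub_le (h : BoundedDerivs g g₁ g₂ g₃ M₁ M₂ M₃)
    (hg : ∀ t, |g t| ≤ 1) (hβ : 0 < β) {μ : Measure Ω} [IsProbabilityMeasure μ]
    {X : κ → Ω → ι → ℝ} (hXm : ∀ i, Measurable (X i)) (hind : iIndepFun X μ)
    (hX2 : ∀ i, MemLp (X i) 2 μ) (hX0 : ∀ i j, ∫ ω, X i ω j ∂μ = 0)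
    (γ : Measure (ι → ℝ)) [IsGaussian γ] (hγ : ∫ x, x ∂γ = 0)
    {A₁ A₂ : Ω → ℝ} {T : κ → Ω → ℝ} (hA₁i : Integrable A₁ μ) (hA₂i : Integrable A₂ μ)
    (hTi : ∀ i, Integrable (T i) μ)
    (hA₁ : ∀ ω j k, |∑ i, X i ω j * X i ω k - ∫ y, y j * y k ∂γ| ≤ A₁ ω)
    (hA₂ : ∀ ω j, ∑ i, |X i ω j| ^ 3 ≤ A₂ ω) (hT0 : ∀ i ω, 0 ≤ T i ω)
    (hT : ∀ i ω, (∃ j, 1 < |β * X i ω j|) → ∀ j, |X i ω j| ^ 3 ≤ T i ω) :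
    |∫ ω, g (smoothMax β (∑ i, X i ω)) ∂μ - ∫ y, g (smoothMax β y) ∂γ|
      ≤ 2 * ((M₂ + 2 * β * M₁) * ∫ ω, A₁ ω ∂μ
        + thirdCoeff β M₁ M₂ M₃ * (Real.exp 2 * ∫ ω, A₂ ω ∂μ + ∑ i, ∫ ω, T i ω ∂μ)) := by
  classical
  have := h.nonneg₁
  have := h.nonneg₂
  have := h.nonneg₃
  have hc := h.continuous
  have hc₁ := h.continuous₁
  have hc₂ := h.continuous₂
  have hK : 0 ≤ thirdCoeff β M₁ M₂ M₃ := by unfold thirdCoeff; positivity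
  set P := μ.prod γ
  set σ : ι → ι → ℝ := fun j k => ∫ y, y j * y k ∂γ with hσ
  let S : Ω → ι → ℝ := fun ω => ∑ i, X i ω
  have hSm : Measurable S := Finset.measurable_sum _ fun i _ => hXm i
  -- The path runs from the Gaussian at θ = 0 to the sum at θ = π/2, with velocity `V`. Since S and
  -- y are independent with matching covariances, the path keeps the covariance fixed, so the
  -- second-order terms cancel on average.
  let W : ℝ → Ω × (ι → ℝ) → ι → ℝ := fun θ z => Real.sin θ • S z.1 + Real.cos θ • z.2
  let V : ℝ → Ω × (ι → ℝ) → ι → ℝ := fun θ z => Real.cos θ • S z.1 - Real.sin θ • z.2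
  have hWm : ∀ θ, Measurable (W θ) := fun θ => by fun_prop
  have hVm : ∀ θ, Measurable (V θ) := fun θ => by fun_prop
  -- joint measurability of the building blocks
  have mdir : ∀ {x u : Ω × (ι → ℝ) → ι → ℝ}, Measurable x → Measurable u →
      AEStronglyMeasurable (fun z => dir₁ β g₁ (x z) (u z)) P := fun hx hu =>
    ((Continuous.dir₁ (α := (ι → ℝ) × (ι → ℝ)) hc₁ continuous_fst continuous_snd).measurable.comp
      (hx.prodMk hu)).aestronglyMeasurable
  have mhess : ∀ {x : Ω × (ι → ℝ) → ι → ℝ} {m : Ω × (ι → ℝ) → ι → ι → ℝ}, Measurable x →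
      Measurable m → AEStronglyMeasurable (fun z => hess β g₁ g₂ (x z) (m z)) P := fun hx hm =>
    ((Continuous.hess (α := (ι → ℝ) × (ι → ι → ℝ)) hc₁ hc₂ continuous_fst
      continuous_snd).measurable.comp (hx.prodMk hm)).aestronglyMeasurable
  have hXn : ∀ i, Integrable (fun ω => ‖X i ω‖) μ := fun i =>
    ((hX2 i).integrable (by norm_num)).norm
  have hXn2 : ∀ i, Integrable (fun ω => ‖X i ω‖ ^ 2) μ := fun i => by
    simpa using (hX2 i).integrable_norm_pow (by norm_num)
  have hSn : Integrable (fun ω => ‖S ω‖) μ :=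
    (integrable_finsetSum _ fun i _ => (hX2 i).integrable (by norm_num)).norm
  have hyn : Integrable (fun y : ι → ℝ => ‖y‖) γ := IsGaussian.integrable_id.norm
  have hXi : ∀ i j, Integrable (fun ω => X i ω j) μ := fun i j =>
    ((hX2 i).integrable (by norm_num)).eval j
  have hVb : ∀ θ z j, |V θ z j| ≤ ‖S z.1‖ + ‖z.2‖ := by
    intro θ z j
    refine (abs_sub _ _).trans (add_le_add ?_ ?_)
    · simp only [Pi.smul_apply, smul_eq_mul, abs_mul]
      exact (mul_le_of_le_one_left (abs_nonneg _) (Real.abs_cos_le_one θ)).trans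
        (norm_le_pi_norm (S z.1) j)
    · simp only [Pi.smul_apply, smul_eq_mul, abs_mul]
      exact (mul_le_of_le_one_left (abs_nonneg _) (Real.abs_sin_le_one θ)).trans
        (norm_le_pi_norm z.2 j)
  have hbV : Integrable (fun z : Ω × (ι → ℝ) => ‖S z.1‖ + ‖z.2‖) P :=
    (hSn.comp_fst γ).add (hyn.comp_snd μ)
  let Φ : ℝ → ℝ := fun θ => ∫ z, g (smoothMax β (W θ z)) ∂P
  have mg : ∀ θ, AEStronglyMeasurable (fun z => g (smoothMax β (W θ z))) P := fun θ =>
    ((hc.comp (continuous_smoothMax β)).measurable.comp (hWm θ)).aestronglyMeasurable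
  have hΦ : ∀ θ, HasDerivAt Φ (∫ z, dir₁ β g₁ (W θ z) (V θ z) ∂P) θ := fun θ =>
    (hasDerivAt_integral_of_dominated_loc_of_deriv_le (μ := P)
      (F := fun θ z => g (smoothMax β (W θ z))) (F' := fun θ z => dir₁ β g₁ (W θ z) (V θ z))
      (x₀ := θ) (s := Set.univ) (bound := fun z => M₁ * (‖S z.1‖ + ‖z.2‖)) Filter.univ_mem
      (.of_forall mg)
      ((integrable_const (1 : ℝ)).mono' (mg θ) (.of_forall fun z => hg _))
      (mdir (hWm θ) (hVm θ))
      (.of_forall fun z r _ => abs_dir₁_le h.bound₁ _ (hVb r z))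
      (hbV.const_mul _)
      (.of_forall fun z r _ => by
        refine hasDerivAt_comp_smoothMax hβ.ne' h.hasDeriv (fun j => ?_)
        refine (((Real.hasDerivAt_sin r).mul_const (S z.1 j)).add
          ((Real.hasDerivAt_cos r).mul_const (z.2 j))).congr_deriv ?_
        simp [V]; ring)).2
  -- integrability of the terms of the derivative
  have iX : ∀ (i : κ) {x : Ω × (ι → ℝ) → ι → ℝ}, Measurable x →
      Integrable (fun z => dir₁ β g₁ (x z) (X i z.1)) P := fun i x hx =>
    (((hXn i).comp_fst γ).const_mul M₁).mono' (mdir hx ((hXm i).comp measurable_fst))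
      (.of_forall fun z => abs_dir₁_le h.bound₁ _ (norm_le_pi_norm (X i z.1)))
  have iY : ∀ {x : Ω × (ι → ℝ) → ι → ℝ}, Measurable x →
      Integrable (fun z => dir₁ β g₁ (x z) z.2) P := fun hx =>
    ((hyn.comp_snd μ).const_mul M₁).mono' (mdir hx measurable_snd)
      (.of_forall fun z => abs_dir₁_le h.bound₁ _ (norm_le_pi_norm z.2))
  have iXX : ∀ (i : κ) θ, Integrable
      (fun z => hess β g₁ g₂ (W θ z) (fun j k => X i z.1 j * X i z.1 k)) P := fun i θ => by
    have hm : Measurable fun z : Ω × (ι → ℝ) => X i z.1 := (hXm i).comp measurable_fst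
    refine (((hXn2 i).comp_fst γ).const_mul (M₂ + 2 * β * M₁)).mono'
      (mhess (hWm θ) (by fun_prop)) (.of_forall fun z =>
        abs_hess_le hβ h.bound₁ h.bound₂ _ fun j k => ?_)
    rw [abs_mul, sq]
    exact mul_le_mul (norm_le_pi_norm (X i z.1) j) (norm_le_pi_norm (X i z.1) k) (abs_nonneg _) (norm_nonneg _)
  have iσ : ∀ θ, Integrable (fun z => hess β g₁ g₂ (W θ z) σ) P := fun θ =>
    (integrable_const ((M₂ + 2 * β * M₁) * ∑ j, ∑ k, |σ j k|)).mono'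
      (mhess (hWm θ) measurable_const) (.of_forall fun z =>
        abs_hess_le hβ h.bound₁ h.bound₂ _ fun j k =>
          (Finset.single_le_sum (f := fun k => |σ j k|) (fun _ _ => abs_nonneg _)
            (Finset.mem_univ k)).trans
          (Finset.single_le_sum (f := fun j => ∑ k, |σ j k|)
            (fun _ _ => Finset.sum_nonneg fun _ _ => abs_nonneg _) (Finset.mem_univ j)))
  -- By Fubini S ω is frozen and acts as a shift in the integration by parts.
  have eY : ∀ θ, ∫ z, dir₁ β g₁ (W θ z) z.2 ∂P
      = Real.cos θ * ∫ z, hess β g₁ g₂ (W θ z) σ ∂P := by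
    intro θ
    rw [integral_prod _ (iY (hWm θ)), integral_prod _ (iσ θ), ← integral_const_mul]
    refine integral_congr_ae (.of_forall fun ω => ?_)
    exact integral_dir₁_gaussian h hβ γ hγ (Real.sin θ • S ω) (Real.cos θ)
  have mL : ∀ i θ, Measurable fun z : Ω × (ι → ℝ) => W θ z - Real.sin θ • X i z.1 :=
    fun i θ => by
      have hm : Measurable fun z : Ω × (ι → ℝ) => X i z.1 := (hXm i).comp measurable_fst
      exact (hWm θ).sub (hm.const_smul (Real.sin θ))
  have eX : ∀ i θ, ∫ z, dir₁ β g₁ (W θ z - Real.sin θ • X i z.1) (X i z.1) ∂P = 0 := by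
    intro i θ
    rw [integral_prod_symm _ (iX i (mL i θ))]
    refine integral_eq_zero_of_ae (.of_forall fun y => ?_)
    have hR : Measurable (∑ k ∈ Finset.univ.erase i, X k) := by
      have : (∑ k ∈ Finset.univ.erase i, X k) = fun ω => ∑ k ∈ Finset.univ.erase i, X k ω := by
        funext ω; simp
      rw [this]
      exact Finset.measurable_sum _ fun k _ => hXm k
    have hRV : IndepFun (∑ k ∈ Finset.univ.erase i, X k) (X i) μ :=
      hind.indepFun_finsetSum_of_notMem hXm (Finset.notMem_erase i _)
    have := integral_dir₁_leaveOut (β := β) h hR (hXm i) hRV (hXi i) (hX0 i) (Real.sin θ)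
      (Real.cos θ • y)
    rw [Pi.zero_apply, ← this]
    refine integral_congr_ae (.of_forall fun ω => ?_)
    simp only [W, S]
    congr 1
    rw [← Finset.add_sum_erase Finset.univ (fun k => X k ω) (Finset.mem_univ i),
      Finset.sum_apply, smul_add]
    abel
  -- The Hessian is taken at the full W, not at the leave-one-out point, so that its sum over i can
  -- be set against the covariance before any absolute value is taken.
  let ρ : ℝ → κ → Ω × (ι → ℝ) → ℝ := fun θ i z =>
    dir₁ β g₁ (W θ z) (X i z.1) - dir₁ β g₁ (W θ z - Real.sin θ • X i z.1) (X i z.1)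
      - Real.sin θ * hess β g₁ g₂ (W θ z) (fun j k => X i z.1 j * X i z.1 k)
  have hρi : ∀ θ i, Integrable (ρ θ i) P := fun θ i =>
    ((iX i (hWm θ)).sub (iX i (mL i θ))).sub ((iXX i θ).const_mul _)
  have hdecomp : ∀ θ, ∫ z, dir₁ β g₁ (W θ z) (V θ z) ∂P
      = ∫ z, (Real.sin θ * Real.cos θ * hess β g₁ g₂ (W θ z)
          (fun j k => ∑ i, X i z.1 j * X i z.1 k - σ j k) + Real.cos θ * ∑ i, ρ θ i z) ∂P := by
    intro θ
    -- The first group is the error that will be estimated. The last two integrate to zero, by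
    -- Gaussian integration by parts and by leave-one-out centering.
    have e1 : ∀ z, dir₁ β g₁ (W θ z) (V θ z)
        = (Real.sin θ * Real.cos θ * hess β g₁ g₂ (W θ z)
          (fun j k => ∑ i, X i z.1 j * X i z.1 k - σ j k) + Real.cos θ * ∑ i, ρ θ i z)
          + (Real.sin θ * (Real.cos θ * hess β g₁ g₂ (W θ z) σ - dir₁ β g₁ (W θ z) z.2)
          + Real.cos θ * ∑ i, dir₁ β g₁ (W θ z - Real.sin θ • X i z.1) (X i z.1)) := by
      intro z
      have hV : dir₁ β g₁ (W θ z) (V θ z)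
          = Real.cos θ * ∑ i, dir₁ β g₁ (W θ z) (X i z.1)
            - Real.sin θ * dir₁ β g₁ (W θ z) z.2 := by
        have : V θ z = fun j => Real.cos θ * (∑ i, X i z.1 j) - Real.sin θ * z.2 j := by
          funext j; simp [V, S, Finset.sum_apply]
        simp only [dir₁, this]
        rw [gibbsMean_sub β (W θ z) (fun j => Real.cos θ * (∑ i, X i z.1 j))
          (fun j => Real.sin θ * z.2 j), gibbsMean_smul, gibbsMean_smul,
          gibbsMean_sum Finset.univ β (W θ z) (fun i => X i z.1), ← Finset.mul_sum]
        ring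
      rw [hV, hess_sub β g₁ g₂ (W θ z) (fun j k => ∑ i, X i z.1 j * X i z.1 k) σ,
        hess_sum Finset.univ β g₁ g₂ (W θ z) (fun i j k => X i z.1 j * X i z.1 k)]
      simp only [ρ, Finset.sum_sub_distrib, ← Finset.mul_sum]
      ring
    have i1 : Integrable (fun z => Real.sin θ * (Real.cos θ * hess β g₁ g₂ (W θ z) σ
        - dir₁ β g₁ (W θ z) z.2)) P := (((iσ θ).const_mul _).sub (iY (hWm θ))).const_mul _
    have i2 : Integrable (fun z => Real.cos θ *
        ∑ i, dir₁ β g₁ (W θ z - Real.sin θ • X i z.1) (X i z.1)) P :=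
      (integrable_finsetSum _ fun i _ => iX i (mL i θ)).const_mul _
    have i3 : Integrable (fun z => Real.sin θ * Real.cos θ * hess β g₁ g₂ (W θ z)
        (fun j k => ∑ i, X i z.1 j * X i z.1 k - σ j k) + Real.cos θ * ∑ i, ρ θ i z) P := by
      refine Integrable.add ?_ ((integrable_finsetSum _ fun i _ => hρi θ i).const_mul _)
      refine Integrable.const_mul ?_ _
      have : (fun z => hess β g₁ g₂ (W θ z) (fun j k => ∑ i, X i z.1 j * X i z.1 k - σ j k))
          = fun z => (∑ i, hess β g₁ g₂ (W θ z) (fun j k => X i z.1 j * X i z.1 k))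
            - hess β g₁ g₂ (W θ z) σ := by
        funext z
        rw [hess_sub β g₁ g₂ (W θ z) (fun j k => ∑ i, X i z.1 j * X i z.1 k) σ,
          hess_sum Finset.univ β g₁ g₂ (W θ z) (fun i j k => X i z.1 j * X i z.1 k)]
      rw [this]
      exact (integrable_finsetSum _ fun i _ => iXX i θ).sub (iσ θ)
    have z1 : ∫ z, Real.sin θ * (Real.cos θ * hess β g₁ g₂ (W θ z) σ
        - dir₁ β g₁ (W θ z) z.2) ∂P = 0 := by
      rw [integral_const_mul, integral_sub ((iσ θ).const_mul _) (iY (hWm θ)),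
        integral_const_mul, eY, sub_self, mul_zero]
    have z2 : ∫ z, Real.cos θ *
        ∑ i, dir₁ β g₁ (W θ z - Real.sin θ • X i z.1) (X i z.1) ∂P = 0 := by
      rw [integral_const_mul, integral_finsetSum _ fun i _ => iX i (mL i θ)]
      simp only [eX, Finset.sum_const_zero, mul_zero]
    simp only [e1]
    have i12 : Integrable (fun z => Real.sin θ * (Real.cos θ * hess β g₁ g₂ (W θ z) σ
        - dir₁ β g₁ (W θ z) z.2) + Real.cos θ *
        ∑ i, dir₁ β g₁ (W θ z - Real.sin θ • X i z.1) (X i z.1)) P := i1.add i2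
    rw [integral_add i3 i12, integral_add i1 i2, z1, z2, add_zero, add_zero]
  set B := (M₂ + 2 * β * M₁) * ∫ ω, A₁ ω ∂μ
    + thirdCoeff β M₁ M₂ M₃ * (Real.exp 2 * ∫ ω, A₂ ω ∂μ + ∑ i, ∫ ω, T i ω ∂μ)
  have hbound : ∀ θ ∈ Set.Icc 0 (Real.pi / 2), |∫ z, dir₁ β g₁ (W θ z) (V θ z) ∂P| ≤ B := by
    intro θ hθ
    have hs0 : 0 ≤ Real.sin θ := Real.sin_nonneg_of_nonneg_of_le_pi hθ.1
      (hθ.2.trans (by linarith [Real.pi_pos]))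
    have hs1 := Real.sin_le_one θ
    have hc0 : 0 ≤ Real.cos θ := Real.cos_nonneg_of_neg_pi_div_two_le_of_le
      (by linarith [Real.pi_pos, hθ.1]) hθ.2
    have hc1 := Real.cos_le_one θ
    have hT' : Integrable (fun ω => ∑ i, T i ω) μ := integrable_finsetSum _ fun i _ => hTi i
    have hA₂' : Integrable (fun ω => Real.exp 2 * A₂ ω + ∑ i, T i ω) μ :=
      (hA₂i.const_mul _).add hT'
    have hBi : Integrable (fun ω => (M₂ + 2 * β * M₁) * A₁ ω + thirdCoeff β M₁ M₂ M₃ *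
        (Real.exp 2 * A₂ ω + ∑ i, T i ω)) μ :=
      (hA₁i.const_mul _).add (hA₂'.const_mul _)
    have hBe : B = ∫ z : Ω × (ι → ℝ), ((M₂ + 2 * β * M₁) * A₁ z.1 + thirdCoeff β M₁ M₂ M₃ *
        (Real.exp 2 * A₂ z.1 + ∑ i, T i z.1)) ∂P := by
      rw [integral_fun_fst (fun ω => (M₂ + 2 * β * M₁) * A₁ ω + thirdCoeff β M₁ M₂ M₃ *
        (Real.exp 2 * A₂ ω + ∑ i, T i ω)), probReal_univ, one_smul,
        integral_add (hA₁i.const_mul _) (hA₂'.const_mul _), integral_const_mul,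
        integral_const_mul, integral_add (hA₂i.const_mul _) hT', integral_const_mul,
        integral_finsetSum _ fun i _ => hTi i]
    rw [hdecomp, hBe, ← Real.norm_eq_abs]
    refine norm_integral_le_of_norm_le (hBi.comp_fst γ) (.of_forall fun z => ?_)
    refine (norm_add_le _ _).trans (add_le_add ?_ ?_)
    · rw [norm_mul, Real.norm_of_nonneg (mul_nonneg hs0 hc0)]
      exact (mul_le_of_le_one_left (norm_nonneg _) (mul_le_one₀ hs1 hc0 hc1)).trans
        (abs_hess_le hβ h.bound₁ h.bound₂ _ (hA₁ z.1))
    · rw [norm_mul, Real.norm_of_nonneg hc0]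
      refine (mul_le_of_le_one_left (norm_nonneg _) hc1).trans ?_
      refine (norm_sum_le _ _).trans ((Finset.sum_le_sum fun i _ =>
        abs_dir₁_sub_sub_hess_le h hβ (W θ z) (X i z.1) hs0 hs1 (hT0 i z.1) (hT i z.1)).trans ?_)
      rw [← Finset.mul_sum, Finset.sum_add_distrib, ← Finset.mul_sum]
      refine mul_le_mul_of_nonneg_left (add_le_add_left (mul_le_mul_of_nonneg_left ?_
        (Real.exp_pos 2).le) _) hK
      -- All means use the same weights at W, so the sum over i moves inside and the maximum over j
      -- is taken only afterwards.
      rw [← gibbsMean_sum Finset.univ β (W θ z) (fun i j => |X i z.1 j| ^ 3)]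
      exact gibbsMean_le_of_le _ _ (hA₂ z.1)
  have hmv := norm_image_sub_le_of_norm_deriv_le_segment' (a := 0) (b := Real.pi / 2) (C := B)
    (f := Φ) (fun x _ => (hΦ x).hasDerivWithinAt)
    (fun x hx => hbound x (Set.Ico_subset_Icc_self hx)) (Real.pi / 2)
    ⟨by positivity, le_rfl⟩
  have hB0 : 0 ≤ B := (abs_nonneg _).trans (hbound 0 ⟨le_rfl, by positivity⟩)
  have e1 : Φ (Real.pi / 2) = ∫ ω, g (smoothMax β (∑ i, X i ω)) ∂μ := by
    have := integral_fun_fst (μ := μ) (ν := γ) (fun ω => g (smoothMax β (S ω)))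
    simpa [Φ, W, P] using this
  have e0 : Φ 0 = ∫ y, g (smoothMax β y) ∂γ := by
    have := integral_fun_snd (μ := μ) (ν := γ) (fun y => g (smoothMax β y))
    simpa [Φ, W, P] using this
  rw [e1, e0, Real.norm_eq_abs, sub_zero] at hmv
  calc _ ≤ B * (Real.pi / 2) := hmv
    _ ≤ B * 2 := mul_le_mul_of_nonneg_left (by linarith [Real.pi_le_four]) hB0
    _ = 2 * B := mul_comm _ _

end MaxCoupling

/-! ### Finite transport from Hall's theorem. -/

namespace MaxCoupling

/-- An approximate max-flow min-cut statement: marginals satisfying Hall's condition up to `ε`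
admit a subcoupling supported on the relation `R` of mass almost `∑ p - ε`. -/
theorem exists_subcoupling {I J : Type*} [Fintype I] [Fintype J] {p : I → ℝ} {q : J → ℝ}
    (hp : ∀ i, 0 ≤ p i) (hq : ∀ j, 0 ≤ q j) (R : I → J → Prop) {ε η : ℝ} (hη : 0 < η)
    (hε : 0 ≤ ε)
    (hR : ∀ A : Finset I, ∀ B : Finset J, (∀ j, j ∈ B ↔ ∃ i ∈ A, R i j) →
      ∑ i ∈ A, p i ≤ ∑ j ∈ B, q j + ε) :
    ∃ w : I → J → ℝ, (∀ i j, 0 ≤ w i j) ∧ (∀ i, ∑ j, w i j ≤ p i) ∧ (∀ j, ∑ i, w i j ≤ q j) ∧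
      (∀ i j, ¬ R i j → w i j = 0) ∧ ∑ i, p i - ε - η ≤ ∑ i, ∑ j, w i j := by
  classical
  -- Masses are cut into tokens of size 1/N. Rounding p costs at most |I| tokens, rounding q at most
  -- |J|, and the ceiling of Nε at most one; N makes the total loss less than η.
  obtain ⟨N, hN⟩ := exists_nat_gt ((Fintype.card I + Fintype.card J + 1) / η)
  have hN0 : (0 : ℝ) < N := lt_of_le_of_lt (by positivity) hN
  rw [div_lt_iff₀ hη] at hN
  let a : I → ℕ := fun i => ⌊N * p i⌋₊
  let b : J → ℕ := fun j => ⌊N * q j⌋₊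
  -- Dummy tokens, admissible for every left token, absorb the defect ε and the rounding of q, so
  -- that Hall's condition holds exactly. Left tokens matched to them are discarded.
  let m : ℕ := ⌈N * ε⌉₊ + Fintype.card J
  let L := Σ i, Fin (a i)
  let T := (Σ j, Fin (b j)) ⊕ Fin m
  let t : L → Finset T := fun l =>
    Finset.univ.filter fun r => Sum.elim (fun r => R l.1 r.1) (fun _ => True) r
  have ha : ∀ i, (a i : ℝ) ≤ N * p i := fun i => Nat.floor_le (mul_nonneg hN0.le (hp i))
  have ha' : ∀ i, N * p i - 1 ≤ (a i : ℝ) := fun i => (Nat.sub_one_lt_floor _).le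
  have hb : ∀ j, (b j : ℝ) ≤ N * q j := fun j => Nat.floor_le (mul_nonneg hN0.le (hq j))
  have hb' : ∀ j, N * q j - 1 ≤ (b j : ℝ) := fun j => (Nat.sub_one_lt_floor _).le
  have hall : ∀ S : Finset L, S.card ≤ (S.biUnion t).card := by
    intro S
    rcases S.eq_empty_or_nonempty with rfl | ⟨l₀, hl₀⟩
    · simp
    set A := S.image Sigma.fst with hA
    set B : Finset J := Finset.univ.filter fun j => ∃ i ∈ A, R i j with hB
    have h1 : S.card ≤ ∑ i ∈ A, a i := by
      have : S ⊆ A.sigma fun i => (Finset.univ : Finset (Fin (a i))) := fun l hl =>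
        Finset.mem_sigma.mpr ⟨Finset.mem_image_of_mem _ hl, Finset.mem_univ _⟩
      exact (Finset.card_le_card this).trans_eq ((Finset.card_sigma _ _).trans
        (Finset.sum_congr rfl fun i _ => Finset.card_fin _))
    have h2 : ∑ j ∈ B, b j + m ≤ (S.biUnion t).card := by
      have : (B.sigma fun j => (Finset.univ : Finset (Fin (b j)))).disjSum
          (Finset.univ : Finset (Fin m)) ⊆ S.biUnion t := by
        intro r hr
        rw [Finset.mem_biUnion]
        rcases r with r | r
        · have hr' : r.1 ∈ B := by simpa using hr
          obtain ⟨i, hi, hij⟩ := (Finset.mem_filter.mp hr').2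
          obtain ⟨l, hl, rfl⟩ := Finset.mem_image.mp hi
          exact ⟨l, hl, by simpa [t] using hij⟩
        · exact ⟨l₀, hl₀, by simp [t]⟩
      simpa using Finset.card_le_card this
    have h3 := hR A B (by simp [hB])
    have h4 : ((∑ i ∈ A, a i : ℕ) : ℝ) ≤ ((∑ j ∈ B, b j + m : ℕ) : ℝ) := by
      push_cast
      have hs1 : ∑ i ∈ A, (a i : ℝ) ≤ N * ∑ i ∈ A, p i := by
        rw [Finset.mul_sum]; exact Finset.sum_le_sum fun i _ => ha i
      have hs2 : N * ∑ j ∈ B, q j - B.card ≤ ∑ j ∈ B, (b j : ℝ) := by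
        have := Finset.sum_le_sum fun j (_ : j ∈ B) => hb' j
        simpa [Finset.sum_sub_distrib, ← Finset.mul_sum] using this
      have hs3 : (B.card : ℝ) ≤ Fintype.card J := by exact_mod_cast Finset.card_le_univ B
      have hs4 : N * ε ≤ (⌈N * ε⌉₊ : ℝ) := Nat.le_ceil _
      have hs5 := mul_le_mul_of_nonneg_left h3 hN0.le
      simp only [m]
      push_cast
      linarith
    exact h1.trans ((Nat.cast_le.mp h4).trans h2)
  obtain ⟨f, hfi, hft⟩ := (Finset.all_card_le_biUnion_card_iff_exists_injective t).mp hall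
  let col : T → Option J := Sum.elim (fun r => some r.1) (fun _ => none)
  let c : I → J → ℝ := fun i j => ∑ l : L, if l.1 = i ∧ col (f l) = some j then 1 else 0
  have hinj : ∀ F : T → ℝ, (∀ r, 0 ≤ F r) → ∑ l, F (f l) ≤ ∑ r, F r := fun F hF => by
    have e : ∑ l, F (f l) = ∑ r ∈ Finset.univ.map ⟨f, hfi⟩, F r := by rw [Finset.sum_map]; rfl
    rw [e]
    exact Finset.sum_le_sum_of_subset_of_nonneg (Finset.subset_univ _) fun r _ _ => hF r
  have hc0 : ∀ i j, 0 ≤ c i j := fun i j => Finset.sum_nonneg fun l _ => by split_ifs <;> norm_num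
  have hrow : ∀ i, ∑ j, c i j ≤ a i := by
    intro i
    simp only [c]
    rw [Finset.sum_comm]
    calc ∑ l : L, ∑ j, (if l.1 = i ∧ col (f l) = some j then (1 : ℝ) else 0)
        ≤ ∑ l : L, if l.1 = i then 1 else 0 := by
          refine Finset.sum_le_sum fun l _ => ?_
          cases hcol : col (f l) <;> by_cases hl : l.1 = i <;> simp [hl]
      _ = a i := by
          rw [Fintype.sum_sigma]
          have e : ∀ x, (∑ _y : Fin (a x), if x = i then (1 : ℝ) else 0)
              = if x = i then (a x : ℝ) else 0 := fun x => by
            rw [Finset.sum_const, Finset.card_fin, nsmul_eq_mul, mul_ite, mul_one, mul_zero]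
          exact (Finset.sum_congr rfl fun x _ => e x).trans (by simp)
  have hcol : ∀ j, ∑ i, c i j ≤ b j := by
    intro j
    simp only [c]
    rw [Finset.sum_comm]
    calc ∑ l : L, ∑ i, (if l.1 = i ∧ col (f l) = some j then (1 : ℝ) else 0)
        = ∑ l : L, if col (f l) = some j then 1 else 0 := by
          refine Finset.sum_congr rfl fun l _ => ?_
          by_cases hl : col (f l) = some j <;> simp [hl]
      _ ≤ ∑ r : T, if col r = some j then 1 else 0 :=
          hinj (fun r => if col r = some j then 1 else 0) fun r => by split_ifs <;> norm_num
      _ = b j := by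
          rw [Fintype.sum_sum_type, Fintype.sum_sigma]
          simp [col]
  have htot : ∑ i, (a i : ℝ) - m ≤ ∑ i, ∑ j, c i j := by
    have e1 : ∑ i, ∑ j, c i j = ∑ l : L, (1 - if col (f l) = none then (1 : ℝ) else 0) := by
      simp only [c]
      calc _ = ∑ i, ∑ l : L, ∑ j, (if l.1 = i ∧ col (f l) = some j then (1 : ℝ) else 0) :=
            Finset.sum_congr rfl fun i _ => Finset.sum_comm
        _ = ∑ l : L, ∑ i, ∑ j, (if l.1 = i ∧ col (f l) = some j then (1 : ℝ) else 0) :=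
            Finset.sum_comm
        _ = _ := by
            refine Finset.sum_congr rfl fun l _ => ?_
            rw [Finset.sum_eq_single l.1 (fun i _ hi => by simp [hi.symm]) (by simp)]
            cases hcol : col (f l) <;> simp
    have e2 := hinj (fun r => if col r = none then 1 else 0) fun r => by split_ifs <;> norm_num
    have e3 : ∑ r : T, (if col r = none then (1 : ℝ) else 0) = m := by
      rw [Fintype.sum_sum_type, Fintype.sum_sigma]
      simp [col]
    have e4 : ∑ _l : L, (1 : ℝ) = ∑ i, (a i : ℝ) := by
      rw [Fintype.sum_sigma]; simp
    rw [e1, Finset.sum_sub_distrib, e4]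
    linarith
  refine ⟨fun i j => c i j / N, fun i j => div_nonneg (hc0 i j) hN0.le, fun i => ?_, fun j => ?_,
    fun i j hij => ?_, ?_⟩
  · rw [← Finset.sum_div, div_le_iff₀ hN0, mul_comm]
    exact (hrow i).trans (ha i)
  · rw [← Finset.sum_div, div_le_iff₀ hN0, mul_comm]
    exact (hcol j).trans (hb j)
  · have : c i j = 0 := by
      refine Finset.sum_eq_zero fun l _ => if_neg ?_
      rintro ⟨rfl, hlj⟩
      have hfl := hft l
      cases hr : f l with
      | inl r =>
        rw [hr] at hlj hfl
        have e : r.1 = j := by simpa [col] using hlj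
        exact hij (by simpa [t, e] using hfl)
      | inr r => rw [hr] at hlj; simp [col] at hlj
    simp only [this, zero_div]
  · simp only [← Finset.sum_div]
    rw [le_div_iff₀ hN0]
    have hs1 : N * ∑ i, p i - Fintype.card I ≤ ∑ i, (a i : ℝ) := by
      have := Finset.sum_le_sum fun i (_ : i ∈ Finset.univ) => ha' i
      simpa [Finset.sum_sub_distrib, ← Finset.mul_sum] using this
    have hs2 : (⌈N * ε⌉₊ : ℝ) < N * ε + 1 := Nat.ceil_lt_add_one (by positivity)
    have hm : (m : ℝ) = ⌈N * ε⌉₊ + Fintype.card J := by simp [m]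
    nlinarith

/-- Completion of a subcoupling to the density, relative to the product, of a coupling. -/
theorem exists_coupling_density {I J : Type*} [Fintype I] [Fintype J] {p : I → ℝ} {q : J → ℝ}
    (hp : ∀ i, 0 ≤ p i) (hq : ∀ j, 0 ≤ q j) (hp1 : ∑ i, p i = 1) (hq1 : ∑ j, q j = 1)
    (R : I → J → Prop) {ε η : ℝ} (hη : 0 < η) (hε : 0 ≤ ε)
    (hR : ∀ A : Finset I, ∀ B : Finset J, (∀ j, j ∈ B ↔ ∃ i ∈ A, R i j) →
      ∑ i ∈ A, p i ≤ ∑ j ∈ B, q j + ε) :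
    ∃ F : I → J → ℝ, (∀ i j, 0 ≤ F i j) ∧ (∀ i, ∑ j, q j * F i j = 1) ∧
      (∀ j, ∑ i, p i * F i j = 1) ∧
      ∀ E : I → J → ℝ, (∀ i j, R i j → E i j = 0) → (∀ i j, 0 ≤ E i j) → (∀ i j, E i j ≤ 1) →
        ∑ i, p i * ∑ j, q j * (F i j * E i j) ≤ ε + η := by
  obtain ⟨w₀, hw0, hwp, hwq, hwR, hwt⟩ := exists_subcoupling hp hq R (half_pos hη) hε hR
  -- shrink slightly so that the residual mass is positive
  set r : ℝ := (1 + η / 2)⁻¹ with hr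
  have hr0 : 0 < r := by positivity
  have hr1 : r < 1 := inv_lt_one_of_one_lt₀ (by linarith)
  obtain ⟨w, hw⟩ : ∃ w : I → J → ℝ, ∀ i j, w i j = r * w₀ i j := ⟨_, fun _ _ => rfl⟩
  have hw0' : ∀ i j, 0 ≤ w i j := fun i j => by
    rw [hw]; exact mul_nonneg hr0.le (hw0 i j)
  have hrow : ∀ i, ∑ j, w i j ≤ p i := fun i => by
    simp only [hw, ← Finset.mul_sum]
    exact (mul_le_of_le_one_left (Finset.sum_nonneg fun j _ => hw0 i j) hr1.le).trans (hwp i)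
  have hcol : ∀ j, ∑ i, w i j ≤ q j := fun j => by
    simp only [hw, ← Finset.mul_sum]
    exact (mul_le_of_le_one_left (Finset.sum_nonneg fun i _ => hw0 i j) hr1.le).trans (hwq j)
  set s : ℝ := 1 - ∑ i, ∑ j, w i j with hs
  have hsum : ∑ i, ∑ j, w i j = r * ∑ i, ∑ j, w₀ i j := by
    simp only [hw, ← Finset.mul_sum]
  have ht1 : ∑ i, ∑ j, w₀ i j ≤ 1 := hp1 ▸ Finset.sum_le_sum fun i _ => hwp i
  have ht0 : 0 ≤ ∑ i, ∑ j, w₀ i j := Finset.sum_nonneg fun i _ => Finset.sum_nonneg fun j _ => hw0 i j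
  have hs0 : 0 < s := by rw [hs, hsum]; nlinarith
  have hsε : s ≤ ε + η := by
    rw [hp1] at hwt
    have hr2 : 1 - η / 2 ≤ r := by
      rw [hr, ← one_div, le_div_iff₀ (by positivity)]; nlinarith
    rw [hs, hsum]
    nlinarith
  have hzr : ∀ i, p i = 0 → ∀ j, w i j = 0 := fun i hi j =>
    le_antisymm ((Finset.single_le_sum (fun j _ => hw0' i j) (Finset.mem_univ j)).trans
      ((hrow i).trans_eq hi)) (hw0' i j)
  have hzc : ∀ j, q j = 0 → ∀ i, w i j = 0 := fun j hj i =>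
    le_antisymm ((Finset.single_le_sum (fun i _ => hw0' i j) (Finset.mem_univ i)).trans
      ((hcol j).trans_eq hj)) (hw0' i j)
  let u : I → ℝ := fun i => 1 - (∑ j, w i j) / p i
  let v : J → ℝ := fun j => 1 - (∑ i, w i j) / q j
  have hu0 : ∀ i, 0 ≤ u i := fun i => sub_nonneg.mpr (div_le_one_of_le₀ (hrow i) (hp i))
  have hv0 : ∀ j, 0 ≤ v j := fun j => sub_nonneg.mpr (div_le_one_of_le₀ (hcol j) (hq j))
  have hpu : ∀ i, p i * u i = p i - ∑ j, w i j := fun i => by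
    by_cases h : p i = 0
    · simp [h, hzr i h]
    · simp only [u]; field_simp
  have hqv : ∀ j, q j * v j = q j - ∑ i, w i j := fun j => by
    by_cases h : q j = 0
    · simp [h, hzc j h]
    · simp only [v]; field_simp
  have hsu : ∑ i, p i * u i = s := by
    simp only [hpu, Finset.sum_sub_distrib, hp1, hs]
  have hsv : ∑ j, q j * v j = s := by
    simp only [hqv, Finset.sum_sub_distrib, hq1, hs]
    rw [Finset.sum_comm]
  -- The missing marginals are filled by a product of the residuals. Only this part, of total mass s
  -- ≤ ε + η, can charge pairs outside R. It is written as a density relative to p ⊗ q so that it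
  -- lifts to arbitrary laws with these cell masses.
  let F : I → J → ℝ := fun i j => w i j / (p i * q j) + u i * v j / s
  have hqF : ∀ i j, q j * F i j = w i j / p i + u i * (q j * v j) / s := fun i j => by
    have : q j * (w i j / (p i * q j)) = w i j / p i := by
      by_cases h : q j = 0
      · simp [h, hzc j h]
      · by_cases h' : p i = 0
        · simp [h']
        · field_simp
    simp only [F]; rw [mul_add, this]; ring
  have hpF : ∀ i j, p i * F i j = w i j / q j + v j * (p i * u i) / s := fun i j => by
    have : p i * (w i j / (p i * q j)) = w i j / q j := by
      by_cases h : p i = 0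
      · simp [h, hzr i h]
      · by_cases h' : q j = 0
        · simp [h']
        · field_simp
    simp only [F]; rw [mul_add, this]; ring
  have hpqF : ∀ i j, p i * (q j * F i j) = w i j + (p i * u i) * (q j * v j) / s := fun i j => by
    have : p i * (w i j / p i) = w i j := by
      by_cases h : p i = 0
      · simp [h, hzr i h]
      · field_simp
    rw [hqF, mul_add, this]; ring
  refine ⟨F, fun i j => ?_, fun i => ?_, fun j => ?_, fun E hE hE0 hE1 => ?_⟩
  · have := hw0' i j
    have := hp i
    have := hq j
    have := hu0 i
    have := hv0 j
    positivity
  · simp only [hqF]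
    rw [Finset.sum_add_distrib, ← Finset.sum_div, ← Finset.sum_div, ← Finset.mul_sum, hsv,
      mul_div_assoc, div_self hs0.ne']
    simp [u]
  · simp only [hpF]
    rw [Finset.sum_add_distrib, ← Finset.sum_div, ← Finset.sum_div, ← Finset.mul_sum, hsu,
      mul_div_assoc, div_self hs0.ne']
    simp [v]
  · refine le_trans ?_ hsε
    calc ∑ i, p i * ∑ j, q j * (F i j * E i j)
        ≤ ∑ i, ∑ j, (p i * u i) * (q j * v j) / s := by
          refine Finset.sum_le_sum fun i _ => ?_
          rw [Finset.mul_sum]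
          refine Finset.sum_le_sum fun j _ => ?_
          have e : p i * (q j * (F i j * E i j)) = p i * (q j * F i j) * E i j := by ring
          have h0 : 0 ≤ (p i * u i) * (q j * v j) / s := by
            have := hp i
            have := hq j
            have := hu0 i
            have := hv0 j
            positivity
          rw [e, hpqF]
          by_cases h : R i j
          · rw [hE i j h, mul_zero]; exact h0
          · have : w i j = 0 := by simp only [hw, hwR i j h, mul_zero]
            rw [this, zero_add]
            exact mul_le_of_le_one_right h0 (hE1 i j)
      _ = s := by
          simp only [← Finset.sum_div, ← Finset.mul_sum]
          rw [← Finset.sum_mul, hsu, hsv]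
          field_simp

end MaxCoupling

/-! ### Realizing the coupling on the given probability space. -/

namespace MaxCoupling

/-- A law on the line is an image of the uniform law on the closed unit interval; the endpoints are
null. -/
lemma exists_measurable_map_uniform (ρ : Measure ℝ) [IsProbabilityMeasure ρ] :
    ∃ h : ℝ → ℝ, Measurable h ∧ (volume.restrict (Set.Ioo (0 : ℝ) 1)).map h = ρ := by
  obtain ⟨f, hf, hfρ⟩ := ρ.exists_measurable_map_eq
  have hproj : Measurable (Set.projIcc (0 : ℝ) 1 zero_le_one) := continuous_projIcc.measurable
  refine ⟨f ∘ Set.projIcc 0 1 zero_le_one, hf.comp hproj, ?_⟩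
  rw [restrict_Ioo_eq_restrict_Icc, ← unitInterval.measurePreserving_coe.map_eq,
    Measure.map_map (hf.comp hproj) measurable_subtype_coe, ← hfρ]
  congr 1
  funext x
  simp

lemma sum_measureReal_fiber {α I : Type*} [MeasurableSpace α] [MeasurableSpace I]
    [MeasurableSingletonClass I] (m : Measure α) [IsFiniteMeasure m] {f : α → I}
    (hf : Measurable f) (A : Finset I) :
    ∑ i ∈ A, m.real (f ⁻¹' {i}) = m.real {a | f a ∈ A} := by
  rw [← measureReal_biUnion_finset]
  · congr 1; ext a; simp
  · intro i _ j _ hij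
    exact Disjoint.preimage _ (by simpa using hij)
  · exact fun i _ => hf (measurableSet_singleton i)

/-- On a probability space carrying an independent uniform variable, a discretized Hall condition
with respect to a finite measurable index map yields a coupling with prescribed marginal. -/
theorem exists_coupling {Ω : Type*} [MeasurableSpace Ω] {μ : Measure Ω} [IsProbabilityMeasure μ]
    {Z : Ω → ℝ} (hZ : Measurable Z) (hU : HasIndepUniform μ Z) (ν : Measure ℝ)
    [IsProbabilityMeasure ν] {I : Type*} [Fintype I] [MeasurableSpace I]
    [MeasurableSingletonClass I] {idx : ℝ → I} (hidx : Measurable idx) (R : I → I → Prop)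
    {ε η : ℝ} (hη : 0 < η) (hε : 0 ≤ ε)
    (hR : ∀ A B : Finset I, (∀ j, j ∈ B ↔ ∃ i ∈ A, R i j) →
      μ.real {ω | idx (Z ω) ∈ A} ≤ ν.real {y | idx y ∈ B} + ε) :
    ∃ Z' : Ω → ℝ, Measurable Z' ∧ μ.map Z' = ν ∧
      μ.real {ω | ¬ R (idx (Z ω)) (idx (Z' ω))} ≤ ε + η := by
  classical
  obtain ⟨U, hUm, hUu, hUZ⟩ := hU
  have hUlaw : μ.map U = volume.restrict (Set.Ioo (0 : ℝ) 1) := by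
    rw [hUu]; simp [ProbabilityTheory.cond]
  have hiZ : Measurable fun ω => idx (Z ω) := hidx.comp hZ
  set p : I → ℝ := fun i => μ.real ((fun ω => idx (Z ω)) ⁻¹' {i}) with hp
  set q : I → ℝ := fun i => ν.real (idx ⁻¹' {i}) with hq
  have hp1 : ∑ i, p i = 1 := by
    simp only [hp]; rw [sum_measureReal_fiber μ hiZ]; simp
  have hq1 : ∑ i, q i = 1 := by
    simp only [hq]; rw [sum_measureReal_fiber ν hidx]; simp
  obtain ⟨F, hF0, hFq, hFp, hFE⟩ := exists_coupling_density (p := p) (q := q)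
    (fun i => measureReal_nonneg) (fun i => measureReal_nonneg) hp1 hq1 R hη hε
    (fun A B hAB => by
      have h := hR A B hAB
      rwa [← sum_measureReal_fiber μ hiZ, ← sum_measureReal_fiber ν hidx] at h)
  have hint : ∀ f : I → ℝ, ∫ y, f (idx y) ∂ν = ∑ j, q j * f j := by
    intro f
    have hfm : Measurable f := measurable_of_finite f
    rw [← integral_map hidx.aemeasurable hfm.aestronglyMeasurable,
      integral_fintype (Integrable.of_finite)]
    refine Finset.sum_congr rfl fun j _ => ?_
    rw [map_measureReal_apply hidx (measurableSet_singleton j), smul_eq_mul]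
  have hmeas : ∀ f : I → ℝ, Measurable fun y => ENNReal.ofReal (f (idx y)) := fun f =>
    ((measurable_of_finite f).comp hidx).ennreal_ofReal
  have hlint : ∀ f : I → ℝ, (∀ j, 0 ≤ f j) →
      ∫⁻ y, ENNReal.ofReal (f (idx y)) ∂ν = ENNReal.ofReal (∑ j, q j * f j) := by
    intro f hf
    have hi : Integrable (fun y => f (idx y)) ν :=
      (Integrable.of_finite (f := f) (μ := ν.map idx)).comp_measurable hidx
    rw [← hint, ofReal_integral_eq_lintegral_ofReal hi (.of_forall fun y => hf _)]
  -- This is the conditional law of the new variable given the cell of Z: ν reweighted by a factor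
  -- constant on cells. It is sampled by feeding the independent uniform variable into `h i`.
  let κ : I → Measure ℝ := fun i => ν.withDensity fun y => ENNReal.ofReal (F i (idx y))
  have hκ : ∀ i, IsProbabilityMeasure (κ i) := fun i => ⟨by
    rw [withDensity_apply _ MeasurableSet.univ, Measure.restrict_univ, hlint _ (hF0 i), hFq,
      ENNReal.ofReal_one]⟩
  choose h hhm hhκ using fun i => @exists_measurable_map_uniform (κ i) (hκ i)
  let Z' : Ω → ℝ := fun ω => h (idx (Z ω)) (U ω)
  have hZ'm : Measurable Z' := by
    have : Measurable fun z : I × ℝ => h z.1 z.2 := measurable_from_prod_countable_right hhm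
    exact this.comp (hiZ.prodMk hUm)
  have hjoint : ∀ i (B : Set ℝ), MeasurableSet B →
      μ ((fun ω => idx (Z ω)) ⁻¹' {i} ∩ Z' ⁻¹' B) = ENNReal.ofReal (p i) * κ i B := by
    intro i B hB
    have e : (fun ω => idx (Z ω)) ⁻¹' {i} ∩ Z' ⁻¹' B
        = U ⁻¹' (h i ⁻¹' B) ∩ Z ⁻¹' (idx ⁻¹' {i}) := by
      ext ω
      simp only [Set.mem_inter_iff, Set.mem_preimage, Set.mem_singleton_iff, Z']
      constructor
      · rintro ⟨rfl, hB⟩; exact ⟨hB, rfl⟩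
      · rintro ⟨hB, rfl⟩; exact ⟨rfl, hB⟩
    rw [e, hUZ.measure_inter_preimage_eq_mul _ _ (hhm i hB) (hidx (measurableSet_singleton i)),
      mul_comm]
    congr 1
    · rw [hp, ofReal_measureReal]; rfl
    · rw [← Measure.map_apply hUm (hhm i hB), hUlaw, ← Measure.map_apply (hhm i) hB, hhκ]
  have hsplit : ∀ s : Set Ω, MeasurableSet s →
      μ s = ∑ i, μ ((fun ω => idx (Z ω)) ⁻¹' {i} ∩ s) := by
    intro s hs
    rw [← measure_biUnion_finset]
    · congr 1; ext ω; simp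
    · intro i _ j _ hij
      exact (Disjoint.preimage _ (by simpa using hij)).mono Set.inter_subset_left
        Set.inter_subset_left
    · exact fun i _ => (hiZ (measurableSet_singleton i)).inter hs
  refine ⟨Z', hZ'm, ?_, ?_⟩
  · ext B hB
    rw [Measure.map_apply hZ'm hB, hsplit _ (hZ'm hB)]
    simp only [hjoint _ B hB, κ, withDensity_apply _ hB]
    simp only [← lintegral_const_mul _ (hmeas _)]
    rw [← lintegral_finsetSum _ fun i _ => (hmeas _).const_mul _]
    -- The column marginals of the density are one, so the mixture of the conditional laws is ν
    -- itself.
    have : ∀ y, ∑ i, ENNReal.ofReal (p i) * ENNReal.ofReal (F i (idx y)) = 1 := by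
      intro y
      have e : ∀ i, ENNReal.ofReal (p i) * ENNReal.ofReal (F i (idx y))
          = ENNReal.ofReal (p i * F i (idx y)) := fun i =>
        (ENNReal.ofReal_mul measureReal_nonneg).symm
      simp only [e]
      rw [← ENNReal.ofReal_sum_of_nonneg fun i _ => mul_nonneg measureReal_nonneg (hF0 i _), hFp,
        ENNReal.ofReal_one]
    simp [this]
  · let E : I → I → ℝ := fun i j => if R i j then 0 else 1
    have hmE : ∀ i, MeasurableSet {y | ¬ R i (idx y)} := fun i =>
      hidx (Set.toFinite {j | ¬ R i j}).measurableSet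
    have hms : MeasurableSet {ω | ¬ R (idx (Z ω)) (idx (Z' ω))} :=
      (hiZ.prodMk (hidx.comp hZ'm)) (Set.toFinite {z : I × I | ¬ R z.1 z.2}).measurableSet
    have hEκ : ∀ i, κ i {y | ¬ R i (idx y)} = ENNReal.ofReal (∑ j, q j * (F i j * E i j)) := by
      intro i
      rw [← hlint (fun j => F i j * E i j) fun j => mul_nonneg (hF0 i j) (by
        simp only [E]; split_ifs <;> norm_num), withDensity_apply _ (hmE i),
        ← lintegral_indicator (hmE i)]
      refine lintegral_congr fun y => ?_
      by_cases hy : R i (idx y) <;> simp [E, hy]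
    have hn : ∀ i, 0 ≤ ∑ j, q j * (F i j * E i j) := fun i =>
      Finset.sum_nonneg fun j _ => mul_nonneg measureReal_nonneg (mul_nonneg (hF0 i j) (by
        simp only [E]; split_ifs <;> norm_num))
    have hμ : μ {ω | ¬ R (idx (Z ω)) (idx (Z' ω))}
        = ENNReal.ofReal (∑ i, p i * ∑ j, q j * (F i j * E i j)) := by
      rw [hsplit _ hms, ENNReal.ofReal_sum_of_nonneg fun i _ => mul_nonneg measureReal_nonneg (hn i)]
      refine Finset.sum_congr rfl fun i _ => ?_
      rw [ENNReal.ofReal_mul measureReal_nonneg, ← hEκ, ← hjoint i _ (hmE i)]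
      congr 1
      ext ω
      simp only [Set.mem_inter_iff, Set.mem_preimage, Set.mem_singleton_iff, Set.mem_ofPred_eq]
      constructor
      · rintro ⟨rfl, h⟩; exact ⟨rfl, h⟩
      · rintro ⟨rfl, h⟩; exact ⟨rfl, h⟩
    rw [measureReal_def, hμ, ENNReal.toReal_ofReal
      (Finset.sum_nonneg fun i _ => mul_nonneg measureReal_nonneg (hn i))]
    refine hFE E (fun i j h => if_pos h) (fun i j => ?_) fun i j => ?_
    · simp only [E]; split_ifs <;> norm_num
    · simp only [E]; split_ifs <;> norm_num

end MaxCoupling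

/-! ### Grid coupling, moments and sums of Gaussian vectors. -/

namespace MaxCoupling

lemma exists_measureReal_abs_gt_le (ν : Measure ℝ) [IsProbabilityMeasure ν] {η : ℝ} (hη : 0 < η) :
    ∃ r : ℝ, ν.real {y | r < |y|} ≤ η := by
  obtain ⟨K, hK, hKν⟩ := isTightMeasureSet_iff_exists_isCompact_measure_compl_le.mp
    (isTightMeasureSet_singleton (μ := ν)) (ENNReal.ofReal η) (ENNReal.ofReal_pos.mpr hη)
  obtain ⟨r, hr⟩ := hK.isBounded.exists_norm_le
  refine ⟨r, ENNReal.toReal_le_of_le_ofReal hη.le ((measure_mono fun y hy hyK => ?_).trans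
    (hKν ν rfl))⟩
  exact absurd (hr y hyK) (not_le.mpr hy)

/-- A Hall type condition on the cells of a grid of mesh `δ` yields a coupling at distance
at most `3 * δ`, up to an arbitrarily small additional error. -/
theorem exists_grid_coupling {Ω : Type*} [MeasurableSpace Ω] {μ : Measure Ω}
    [IsProbabilityMeasure μ] {Z : Ω → ℝ} (hZ : Measurable Z) (hU : HasIndepUniform μ Z)
    (ν : Measure ℝ) [IsProbabilityMeasure ν] {δ ε η : ℝ} (hδ : 0 < δ) (hε : 0 ≤ ε) (hη : 0 < η)
    (hH : ∀ S : Finset ℤ, μ.real {ω | ⌊Z ω / δ⌋ ∈ S} ≤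
      ν.real {y | ∃ k ∈ S, |⌊y / δ⌋ - k| ≤ 2} + ε) :
    ∃ Z' : Ω → ℝ, Measurable Z' ∧ μ.map Z' = ν ∧
      μ.real {ω | 3 * δ < |Z ω - Z' ω|} ≤ ε + η := by
  classical
  have : IsProbabilityMeasure (μ.map Z) := Measure.isProbabilityMeasure_map hZ.aemeasurable
  obtain ⟨r₁, hr₁⟩ := exists_measureReal_abs_gt_le (μ.map Z) (by positivity : 0 < η / 3)
  obtain ⟨r₂, hr₂⟩ := exists_measureReal_abs_gt_le ν (by positivity : 0 < η / 3)
  set r := max r₁ r₂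
  set K : Finset ℤ := Finset.Icc ⌊-r / δ⌋ ⌊r / δ⌋
  have hout : ∀ y : ℝ, ⌊y / δ⌋ ∉ K → r < |y| := by
    intro y hy
    by_contra h
    rw [not_lt, abs_le] at h
    refine hy (Finset.mem_Icc.mpr ⟨Int.floor_mono ?_, Int.floor_mono ?_⟩)
    · exact div_le_div_of_nonneg_right h.1 hδ.le
    · exact div_le_div_of_nonneg_right h.2 hδ.le
  let : MeasurableSpace (Option K) := ⊤
  -- Cells outside a window of nearly full mass for both laws are merged into `none`, which makes
  -- the index set finite.
  let φ : ℤ → Option K := fun k => if h : k ∈ K then some ⟨k, h⟩ else none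
  let idx : ℝ → Option K := fun y => φ ⌊y / δ⌋
  have hfl : Measurable fun y : ℝ => ⌊y / δ⌋ := Int.measurable_floor.comp (measurable_id.div_const δ)
  have hidx : Measurable idx := (measurable_from_top (f := φ)).comp hfl
  -- The relation holds vacuously as soon as one side is `none`. Hall's condition is then trivial
  -- for sets containing `none`; the price is η/3 for each variable leaving the window.
  let R : Option K → Option K → Prop := fun i j => ∀ k ∈ i, ∀ l ∈ j, |l.1 - k.1| ≤ 2
  have hidx_some : ∀ y (k : K), idx y = some k → ⌊y / δ⌋ = k := by
    intro y k hy
    simp only [idx, φ] at hy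
    split_ifs at hy with h
    exact congrArg Subtype.val (Option.some.inj hy)
  obtain ⟨Z', hZ'm, hZ'ν, hZ'⟩ := exists_coupling hZ hU ν hidx R (by positivity : 0 < η / 3) hε (by
    intro A B hAB
    by_cases hA : none ∈ A
    · have hB : ∀ j, j ∈ B := fun j => (hAB j).mpr ⟨none, hA, fun k hk => by simp at hk⟩
      have : {y | idx y ∈ B} = Set.univ := Set.eq_univ_of_forall fun y => hB _
      rw [this, probReal_univ]
      exact measureReal_le_one.trans (by linarith)
    · set S : Finset ℤ := K.filter fun k => φ k ∈ A
      have h1 : {ω | idx (Z ω) ∈ A} ⊆ {ω | ⌊Z ω / δ⌋ ∈ S} := by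
        intro ω (hω : φ ⌊Z ω / δ⌋ ∈ A)
        change ⌊Z ω / δ⌋ ∈ S
        refine Finset.mem_filter.mpr ⟨?_, hω⟩
        by_contra h
        simp only [φ, dif_neg h] at hω
        exact hA hω
      have h2 : {y | ∃ k ∈ S, |⌊y / δ⌋ - k| ≤ 2} ⊆ {y | idx y ∈ B} := by
        rintro y ⟨k, hk, hyk⟩
        obtain ⟨hkK, hkA⟩ := Finset.mem_filter.mp hk
        refine (hAB _).mpr ⟨φ k, hkA, fun k' hk' l hl => ?_⟩
        have e1 : l.1 = ⌊y / δ⌋ := (hidx_some y l hl).symm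
        have e2 : k'.1 = k := by
          simp only [φ, dif_pos hkK, Option.mem_def, Option.some.injEq] at hk'
          rw [← hk']
        rwa [e1, e2]
      exact (measureReal_mono h1).trans ((hH S).trans
        (add_le_add (measureReal_mono (μ := ν) h2) le_rfl)))
  refine ⟨Z', hZ'm, hZ'ν, ?_⟩
  have hsub : {ω | 3 * δ < |Z ω - Z' ω|} ⊆
      {ω | ¬ R (idx (Z ω)) (idx (Z' ω))} ∪ (Z ⁻¹' {y | r₁ < |y|} ∪ Z' ⁻¹' {y | r₂ < |y|}) := by
    intro ω hω
    by_contra hcon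
    simp only [Set.mem_union, Set.mem_preimage, Set.mem_ofPred_eq, not_or, not_not] at hcon
    obtain ⟨hR, hz, hz'⟩ := hcon
    have hin : ∀ y, ¬ r < |y| → ∃ h : ⌊y / δ⌋ ∈ K, idx y = some ⟨⌊y / δ⌋, h⟩ := by
      intro y hy
      have h : ⌊y / δ⌋ ∈ K := by
        by_contra h
        exact hy (hout y h)
      exact ⟨h, dif_pos h⟩
    obtain ⟨hk, ek⟩ := hin (Z ω) fun h => hz ((le_max_left _ _).trans_lt h)
    obtain ⟨hl, el⟩ := hin (Z' ω) fun h => hz' ((le_max_right _ _).trans_lt h)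
    have h2 := hR _ ek _ el
    simp only at h2
    have h2' : |((⌊Z' ω / δ⌋ : ℤ) : ℝ) - ⌊Z ω / δ⌋| ≤ 2 := by exact_mod_cast h2
    have a1 := Int.floor_le (Z ω / δ)
    have a2 := Int.lt_floor_add_one (Z ω / δ)
    have b1 := Int.floor_le (Z' ω / δ)
    have b2 := Int.lt_floor_add_one (Z' ω / δ)
    -- Indices differ by at most 2, fractional parts by less than 1.
    have h3 : |Z ω / δ - Z' ω / δ| ≤ 3 := by
      rw [abs_le] at h2' ⊢
      constructor <;> linarith [h2'.1, h2'.2]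
    rw [← sub_div, abs_div, abs_of_pos hδ, div_le_iff₀ hδ] at h3
    exact absurd hω (not_lt.mpr h3)
  have hm : ∀ s : ℝ, MeasurableSet {y : ℝ | s < |y|} := fun s =>
    measurableSet_lt measurable_const measurable_id.abs
  have e1 : μ.real (Z ⁻¹' {y | r₁ < |y|}) ≤ η / 3 := by
    rwa [map_measureReal_apply hZ (hm _)] at hr₁
  have e2 : μ.real (Z' ⁻¹' {y | r₂ < |y|}) ≤ η / 3 := by
    rwa [← hZ'ν, map_measureReal_apply hZ'm (hm _)] at hr₂
  calc μ.real {ω | 3 * δ < |Z ω - Z' ω|}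
      ≤ (ε + η / 3) + (η / 3 + η / 3) :=
        (measureReal_mono hsub).trans ((measureReal_union_le _ _).trans (add_le_add hZ'
          ((measureReal_union_le _ _).trans (add_le_add e1 e2))))
    _ = ε + η := by ring

lemma integrable_ciSup {α ι : Type*} [MeasurableSpace α] [Fintype ι] [Nonempty ι] {μ : Measure α}
    {f : ι → α → ℝ} (hf : ∀ i, Integrable (f i) μ) : Integrable (fun a => ⨆ i, f i a) μ := by
  have h : (fun a => ⨆ i, f i a) = Finset.univ.sup' Finset.univ_nonempty f := by
    funext a
    rw [Finset.sup'_apply, Finset.sup'_univ_eq_ciSup]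
  rw [h]
  exact Finset.sup'_induction (p := fun h => Integrable h μ) _ _ (fun _ h₁ _ h₂ => h₁.sup h₂) fun i _ => hf i

/-- This is t² ≤ 1 + |t|³. -/
lemma memLp_two_of_integrable_cube {α : Type*} [MeasurableSpace α] {μ : Measure α}
    [IsFiniteMeasure μ] {f : α → ℝ} (hfm : AEStronglyMeasurable f μ)
    (hf : Integrable (fun a => |f a| ^ 3) μ) : MemLp f 2 μ := by
  rw [memLp_two_iff_integrable_sq hfm]
  refine ((integrable_const (1 : ℝ)).add hf).mono' (hfm.pow 2) (.of_forall fun a => ?_)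
  rw [Real.norm_of_nonneg (sq_nonneg _), ← sq_abs]
  simp only [Pi.add_apply]
  have := abs_nonneg (f a)
  rcases le_total (|f a|) 1 with h | h
  · have := pow_le_one₀ (n := 2) this h
    have : 0 ≤ |f a| ^ 3 := by positivity
    linarith
  · have := pow_le_pow_right₀ h (by norm_num : 2 ≤ 3)
    linarith

variable {n p : ℕ}

/-- The quadratic form at x is the mean of (x · X)². Positivity is needed to read off the covariance
of the corresponding `multivariateGaussian`. -/
lemma posSemidef_secondMoment {Ω : Type*} [MeasurableSpace Ω] {μ : Measure Ω}
    {X : Ω → EuclideanSpace ℝ (Fin p)} (hX : ∀ j, MemLp (fun ω => X ω j) 2 μ) :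
    (secondMoment μ X).PosSemidef := by
  refine .of_dotProduct_mulVec_nonneg ?_ fun x => ?_
  · ext j k
    simp [secondMoment, mul_comm]
  · have hi : ∀ j k, Integrable (fun ω => X ω j * X ω k) μ := fun j k =>
      (hX j).integrable_mul (hX k)
    have e : star x ⬝ᵥ (secondMoment μ X).mulVec x = ∫ ω, (∑ j, x j * X ω j) ^ 2 ∂μ := by
      have : ∀ ω, (∑ j, x j * X ω j) ^ 2 = ∑ j, ∑ k, x j * x k * (X ω j * X ω k) := fun ω => by
        rw [sq, Finset.sum_mul_sum]
        exact Finset.sum_congr rfl fun j _ => Finset.sum_congr rfl fun k _ => by ring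
      simp only [this]
      rw [integral_finsetSum _ fun j _ => integrable_finsetSum _ fun k _ => (hi j k).const_mul _]
      simp only [dotProduct, Matrix.mulVec, secondMoment, Matrix.of_apply, Pi.star_apply,
        star_trivial, Finset.mul_sum]
      refine Finset.sum_congr rfl fun j _ => ?_
      rw [integral_finsetSum _ fun k _ => (hi j k).const_mul _]
      refine Finset.sum_congr rfl fun k _ => ?_
      rw [integral_const_mul]; ring
    rw [e]
    exact integral_nonneg fun ω => sq_nonneg _

/-- The law of a sum of independent centered Gaussian vectors. -/
lemma law_sum_multivariateGaussian {Ω' : Type*} [MeasurableSpace Ω'] {μ' : Measure Ω'}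
    [IsProbabilityMeasure μ'] {Y : Fin n → Ω' → EuclideanSpace ℝ (Fin p)} (hind : iIndepFun Y μ')
    {V : Fin n → Matrix (Fin p) (Fin p) ℝ} (hV : ∀ i, (V i).PosSemidef)
    (hY : ∀ i, HasLaw (Y i) (multivariateGaussian 0 (V i)) μ') :
    HasGaussianLaw (fun ω' j => (∑ i, Y i ω') j) μ' ∧ ∫ ω', (fun j => (∑ i, Y i ω') j) ∂μ' = 0 ∧
      ∀ j k, ∫ ω', (∑ i, Y i ω') j * (∑ i, Y i ω') k ∂μ' = ∑ i, V i j k := by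
  have hG : ∀ i, HasGaussianLaw (Y i) μ' := fun i => (hY i).hasGaussianLaw
  have hS : HasGaussianLaw (fun ω' => ∑ i, Y i ω') μ' := (iIndepFun.hasGaussianLaw hG hind).fun_sum
  have hS' : HasGaussianLaw (fun ω' j => (∑ i, Y i ω') j) μ' :=
    hS.map_equiv_fun (EuclideanSpace.equiv (Fin p) ℝ)
  have h2 : ∀ i j, MemLp (fun ω' => Y i ω' j) 2 μ' := fun i j => (hG i).memLp_two.eval_piLp j
  have h0 : ∀ i j, ∫ ω', Y i ω' j ∂μ' = 0 := by
    intro i j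
    have e1 : ∫ ω', Y i ω' ∂μ' = 0 := by
      rw [(hY i).integral_eq]; simp
    have e2 := (EuclideanSpace.proj (𝕜 := ℝ) j).integral_comp_comm (hG i).integrable
    rw [e1, map_zero] at e2
    simpa using e2
  have e : ∀ ω' j, (∑ i, Y i ω') j = ∑ i, Y i ω' j := fun ω' j => by simp
  have hs0 : ∀ j, ∫ ω', (∑ i, Y i ω') j ∂μ' = 0 := by
    intro j
    simp only [e]
    rw [integral_finsetSum _ fun i _ => (h2 i j).integrable (by norm_num)]
    simp [h0]
  refine ⟨hS', ?_, fun j k => ?_⟩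
  · funext j
    have e2 := (ContinuousLinearMap.proj (R := ℝ) (φ := fun _ : Fin p => ℝ) j).integral_comp_comm
      hS'.integrable
    simp only [ContinuousLinearMap.proj_apply] at e2
    rw [← e2, hs0, Pi.zero_apply]
  · have hm : ∀ j, MemLp (fun ω' => (∑ i, Y i ω') j) 2 μ' := fun j => hS.memLp_two.eval_piLp j
    have hc := covariance_eq_sub (hm j) (hm k)
    rw [hs0, zero_mul, sub_zero] at hc
    change cov[_, _; μ'] = ∫ ω', (∑ i, Y i ω') j * (∑ i, Y i ω') k ∂μ' at hc
    rw [← hc]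
    simp only [e]
    rw [covariance_fun_sum_fun_sum (fun i => h2 i j) (fun i => h2 i k)]
    refine Finset.sum_congr rfl fun i _ => ?_
    rw [Finset.sum_eq_single i _ (by simp)]
    · have := (hY i).covariance_fun_comp (f := fun x => x j) (g := fun x => x k)
        (Measurable.aemeasurable (by fun_prop)) (Measurable.aemeasurable (by fun_prop))
      rw [this, covariance_eval_multivariateGaussian (hV i)]
    · intro l _ hl
      have hil := (hind.indepFun hl.symm).comp (φ := fun x : EuclideanSpace ℝ (Fin p) => x j)
        (ψ := fun x : EuclideanSpace ℝ (Fin p) => x k) (by fun_prop) (by fun_prop)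
      exact hil.covariance_eq_zero (h2 i j) (h2 l k)

end MaxCoupling

/-! ### From indicators of cells to smooth functions, and the error in terms of B₁, B₂, B₄. -/

namespace MaxCoupling

section Cutoff

variable {α ι : Type*} [MeasurableSpace α] {μ : Measure α} [IsProbabilityMeasure μ] [Fintype ι]
  [Nonempty ι] {W : α → ι → ℝ} {δ β : ℝ} {g : ℝ → ℝ} {S : Finset ℤ}

lemma integrable_comp_smoothMax (hW : Measurable W) (hg : Continuous g) (hg0 : ∀ t, 0 ≤ g t)
    (hg1 : ∀ t, g t ≤ 1) : Integrable (fun a => g (smoothMax β (W a))) μ :=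
  (integrable_const (1 : ℝ)).mono'
    ((hg.comp (continuous_smoothMax β)).measurable.comp hW).aestronglyMeasurable
    (.of_forall fun a => by
      rw [Real.norm_of_nonneg (hg0 _)]; exact hg1 _)

/-- If the maximum lies in cell k, the soft maximum lies in [kδ, (k + 2)δ), where g = 1; Markov's
inequality concludes. -/
lemma measureReal_floor_mem_le_integral (hW : Measurable W) (hδ : 0 < δ) (hβ : 0 < β)
    (hlog : β⁻¹ * Real.log (Fintype.card ι) ≤ δ) (hg : Continuous g) (hg0 : ∀ t, 0 ≤ g t)
    (hg1 : ∀ t, g t ≤ 1)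
    (hgS : ∀ k ∈ S, ∀ t : ℝ, k * δ ≤ t → t < (k + 2) * δ → g t = 1) :
    μ.real {a | ⌊(⨆ j, W a j) / δ⌋ ∈ S} ≤ ∫ a, g (smoothMax β (W a)) ∂μ := by
  have h := mul_meas_ge_le_integral_of_nonneg (μ := μ) (.of_forall fun a => hg0 (smoothMax β (W a)))
    (integrable_comp_smoothMax hW hg hg0 hg1) 1
  rw [one_mul] at h
  refine (measureReal_mono fun a ha => ?_).trans h
  have h1 := (le_div_iff₀ hδ).mp (Int.floor_le ((⨆ j, W a j) / δ))
  have h2 := (div_lt_iff₀ hδ).mp (Int.lt_floor_add_one ((⨆ j, W a j) / δ))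
  have h3 := le_smoothMax hβ (W a)
  have h4 := smoothMax_le hβ (W a)
  exact (hgS _ ha _ (by linarith) (by linarith)).ge

/-- Where g is nonzero the soft maximum lies in ((k - 1)δ, (k + 3)δ), so the maximum lies in ((k -
2)δ, (k + 3)δ), and its cell index is between k - 2 and k + 2. -/
lemma integral_le_measureReal_floor (hW : Measurable W) (hδ : 0 < δ) (hβ : 0 < β)
    (hlog : β⁻¹ * Real.log (Fintype.card ι) ≤ δ) (hg : Continuous g) (hg0 : ∀ t, 0 ≤ g t)
    (hg1 : ∀ t, g t ≤ 1)
    (hgS : ∀ t, g t ≠ 0 → ∃ k ∈ S, ((k : ℝ) - 1) * δ < t ∧ t < (k + 3) * δ) :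
    ∫ a, g (smoothMax β (W a)) ∂μ ≤ μ.real {a | ∃ k ∈ S, |⌊(⨆ j, W a j) / δ⌋ - k| ≤ 2} := by
  have hm : Measurable fun a => ⌊(⨆ j, W a j) / δ⌋ := Int.measurable_floor.comp
    ((Measurable.iSup fun j => (measurable_pi_apply j).comp hW).div_const δ)
  have hs : MeasurableSet {a | ∃ k ∈ S, |⌊(⨆ j, W a j) / δ⌋ - k| ≤ 2} :=
    hm (MeasurableSet.of_discrete (s := {l : ℤ | ∃ k ∈ S, |l - k| ≤ 2}))
  rw [← integral_indicator_one hs]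
  refine integral_mono (integrable_comp_smoothMax hW hg hg0 hg1)
    ((integrable_const (1 : ℝ)).indicator hs) fun a => ?_
  by_cases ha : g (smoothMax β (W a)) = 0
  · simp only [ha]
    exact Set.indicator_nonneg (fun _ _ => zero_le_one) _
  · obtain ⟨k, hk, h1, h2⟩ := hgS _ ha
    have h3 := le_smoothMax hβ (W a)
    have h4 := smoothMax_le hβ (W a)
    have hmem : a ∈ {a | ∃ k ∈ S, |⌊(⨆ j, W a j) / δ⌋ - k| ≤ 2} := by
      refine ⟨k, hk, abs_le.mpr ⟨?_, ?_⟩⟩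
      · have : k - 2 ≤ ⌊(⨆ j, W a j) / δ⌋ := by
          rw [Int.le_floor, le_div_iff₀ hδ]; push_cast; linarith
        linarith
      · have : ⌊(⨆ j, W a j) / δ⌋ < k + 3 := by
          rw [Int.floor_lt, div_lt_iff₀ hδ]; push_cast; linarith
        omega
    rw [Set.indicator_of_mem hmem]
    exact hg1 _

end Cutoff

variable {n p : ℕ}

lemma le_ciSup_fin {ι : Type*} [Finite ι] (f : ι → ℝ) (i : ι) : f i ≤ ⨆ i, f i :=
  le_ciSup (Set.finite_range f).bddAbove i

/-- Comparison of the smoothed maxima of a sum of independent centered vectors and of the centered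
Gaussian measure with the same covariance, with the error expressed through `B₁`, `B₂`, `B₄`. -/
theorem abs_integral_smoothMax_sum_sub_le [NeZero p] {Ω : Type*} [MeasurableSpace Ω]
    {μ : Measure Ω} [IsProbabilityMeasure μ] {X : Fin n → Ω → EuclideanSpace ℝ (Fin p)}
    (hXm : ∀ i, Measurable (X i)) (hind : iIndepFun X μ) (hX0 : ∀ i j, ∫ ω, X i ω j ∂μ = 0)
    (hX3 : ∀ i j, Integrable (fun ω => |X i ω j| ^ 3) μ)
    (γ : Measure (Fin p → ℝ)) [IsGaussian γ] (hγ : ∫ x, x ∂γ = 0)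
    (hγc : ∀ j k, ∫ y, y j * y k ∂γ = ∑ i, secondMoment μ (X i) j k)
    {g g₁ g₂ g₃ : ℝ → ℝ} {M₁ M₂ M₃ δ : ℝ} (h : BoundedDerivs g g₁ g₂ g₃ M₁ M₂ M₃)
    (hg : ∀ t, |g t| ≤ 1) (hδ : 0 < δ) (hL : 0 < Real.log (max (p : ℝ) (n : ℝ))) :
    |∫ ω, g (smoothMax (Real.log (max (p : ℝ) (n : ℝ)) / δ) (∑ i, (X i ω).ofLp)) ∂μ -
        ∫ y, g (smoothMax (Real.log (max (p : ℝ) (n : ℝ)) / δ) y) ∂γ| ≤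
      2 * ((M₂ + 2 * (Real.log (max (p : ℝ) (n : ℝ)) / δ) * M₁) * B₁ μ X +
        thirdCoeff (Real.log (max (p : ℝ) (n : ℝ)) / δ) M₁ M₂ M₃ *
          (Real.exp 2 * B₂ μ X + B₄ μ X δ)) := by
  set L := Real.log (max (p : ℝ) (n : ℝ))
  have hXj : ∀ i j, Measurable fun ω => X i ω j := fun i j =>
    (measurable_pi_apply j).comp ((WithLp.measurable_ofLp 2 (Fin p → ℝ)).comp (hXm i))
  have hX2 : ∀ i j, MemLp (fun ω => X i ω j) 2 μ := fun i j =>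
    memLp_two_of_integrable_cube (hXj i j).aestronglyMeasurable (hX3 i j)
  have hmax : ∀ i, Measurable fun ω => maxAbs (X i ω) := fun i =>
    Measurable.iSup fun j => (hXj i j).abs
  refine abs_integral_comp_smoothMax_sub_le h hg (div_pos hL hδ) (X := fun i ω => (X i ω).ofLp)
    (fun i => (WithLp.measurable_ofLp 2 (Fin p → ℝ)).comp (hXm i))
    (hind.comp (fun _ => WithLp.ofLp) fun _ => WithLp.measurable_ofLp 2 (Fin p → ℝ))
    (fun i => MemLp.of_eval (hX2 i)) hX0 γ hγ
    (A₁ := fun ω => ⨆ jk : Fin p × Fin p,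
      |∑ i, (X i ω jk.1 * X i ω jk.2 - ∫ ω', X i ω' jk.1 * X i ω' jk.2 ∂μ)|)
    (A₂ := fun ω => ⨆ j : Fin p, ∑ i, |X i ω j| ^ 3)
    (T := fun i => Set.indicator {ω | δ / L < maxAbs (X i ω)} fun ω => ⨆ j : Fin p, |X i ω j| ^ 3)
    ?_ ?_ ?_ ?_ ?_ ?_ ?_
  · exact integrable_ciSup fun jk => (integrable_finsetSum _ fun i _ =>
      ((hX2 i jk.1).integrable_mul (hX2 i jk.2)).sub (integrable_const _)).abs
  · exact integrable_ciSup fun j => integrable_finsetSum _ fun i _ => hX3 i j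
  · exact fun i => (integrable_ciSup (hX3 i)).indicator (measurableSet_lt measurable_const (hmax i))
  · intro ω j k
    refine le_of_eq_of_le ?_ (le_ciSup_fin (fun jk : Fin p × Fin p =>
      |∑ i, (X i ω jk.1 * X i ω jk.2 - ∫ ω', X i ω' jk.1 * X i ω' jk.2 ∂μ)|) (j, k))
    rw [hγc, Finset.sum_sub_distrib]
    rfl
  · exact fun ω j => le_ciSup_fin (fun j => ∑ i, |X i ω j| ^ 3) j
  · exact fun i ω => Set.indicator_nonneg
      (fun ω _ => Real.iSup_nonneg fun j => by positivity) ω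
  · rintro i ω ⟨j, hj⟩ k
    have hmem : ω ∈ {ω | δ / L < maxAbs (X i ω)} := by
      rw [abs_mul, abs_of_pos (div_pos hL hδ)] at hj
      refine lt_of_lt_of_le ?_ (le_ciSup_fin (fun j => |X i ω j|) j)
      rw [div_lt_iff₀ hL]
      rw [div_mul_eq_mul_div, lt_div_iff₀ hδ] at hj
      linarith
    rw [Set.indicator_of_mem hmem]
    exact le_ciSup_fin (fun j => |X i ω j| ^ 3) k

lemma B₁_nonneg {Ω : Type*} [MeasurableSpace Ω] (μ : Measure Ω)
    (X : Fin n → Ω → EuclideanSpace ℝ (Fin p)) : 0 ≤ B₁ μ X :=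
  integral_nonneg fun _ => Real.iSup_nonneg fun _ => abs_nonneg _

lemma B₂_nonneg {Ω : Type*} [MeasurableSpace Ω] (μ : Measure Ω)
    (X : Fin n → Ω → EuclideanSpace ℝ (Fin p)) : 0 ≤ B₂ μ X :=
  integral_nonneg fun _ => Real.iSup_nonneg fun _ => Finset.sum_nonneg fun _ _ => by positivity

lemma B₄_nonneg {Ω : Type*} [MeasurableSpace Ω] (μ : Measure Ω)
    (X : Fin n → Ω → EuclideanSpace ℝ (Fin p)) (δ : ℝ) : 0 ≤ B₄ μ X δ :=
  Finset.sum_nonneg fun _ _ => integral_nonneg fun ω => Set.indicator_nonneg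
    (fun ω _ => Real.iSup_nonneg fun j => by positivity) ω

/-- With β = L/δ every term carries the right power of δ, and L ≥ 1 lets the top power of L absorb
the others: 1 + 2L ≤ 3L and 1 + 3L + 4L² ≤ 8L². -/
lemma comparison_error_le {M L δ b₁ b₂ b₄ : ℝ} (hM : 0 < M) (hL : 1 ≤ L) (hδ : 0 < δ)
    (h₁ : 0 ≤ b₁) (h₂ : 0 ≤ b₂) (h₄ : 0 ≤ b₄) :
    2 * ((M * δ⁻¹ ^ 2 + 2 * (L / δ) * (M * δ⁻¹)) * b₁ +
        thirdCoeff (L / δ) (M * δ⁻¹) (M * δ⁻¹ ^ 2) (M * δ⁻¹ ^ 3) *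
          (Real.exp 2 * b₂ + b₄)) ≤
      16 * M * Real.exp 2 * (δ⁻¹ ^ 2 * (b₁ + δ⁻¹ * (b₂ + b₄) * L) * L) := by
  have he : 1 ≤ Real.exp 2 := Real.one_le_exp (by norm_num)
  set d := δ⁻¹ with hd
  have hd0 : 0 < d := inv_pos.mpr hδ
  rw [thirdCoeff, div_eq_mul_inv, ← hd]
  have hLL : L ≤ L ^ 2 := by nlinarith
  have t1 : (M * d ^ 2 + 2 * (L * d) * (M * d)) * b₁ ≤ 8 * Real.exp 2 * (M * d ^ 2 * L * b₁) :=
    calc _ = M * d ^ 2 * (1 + 2 * L) * b₁ := by ring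
      _ ≤ M * d ^ 2 * (3 * L) * b₁ := by gcongr; linarith
      _ = 3 * (M * d ^ 2 * L * b₁) := by ring
      _ ≤ _ := by gcongr; linarith
  have t2 : (M * d ^ 3 + 3 * (L * d) * (M * d ^ 2) + 4 * (L * d) ^ 2 * (M * d)) *
      (Real.exp 2 * b₂ + b₄) ≤ 8 * (M * d ^ 3 * L ^ 2) * (Real.exp 2 * (b₂ + b₄)) := by
    gcongr
    · calc _ = M * d ^ 3 * (1 + 3 * L + 4 * L ^ 2) := by ring
        _ ≤ M * d ^ 3 * (8 * L ^ 2) := by gcongr; nlinarith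
        _ = _ := by ring
    · rw [mul_add]; gcongr; exact le_mul_of_one_le_left h₄ he
  calc _ ≤ 2 * (8 * Real.exp 2 * (M * d ^ 2 * L * b₁) +
        8 * (M * d ^ 3 * L ^ 2) * (Real.exp 2 * (b₂ + b₄))) := by gcongr
    _ = _ := by ring

lemma one_le_log_max {n p : ℕ} (hn : 3 ≤ n) : 1 ≤ Real.log (max (p : ℝ) (n : ℝ)) := by
  have h3 : (3 : ℝ) ≤ max (p : ℝ) (n : ℝ) := le_max_of_le_right (by exact_mod_cast hn)
  rw [Real.le_log_iff_exp_le (by linarith)]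
  linarith [Real.exp_one_lt_d9]

end MaxCoupling

/-! ### Proof of the theorem. -/

open MaxCoupling

theorem corollary4p1 :
    ∃ C : ℝ, 0 < C ∧
      ∀ (n p : ℕ), 3 ≤ n → 1 ≤ p →
      ∀ (Ω : Type*) [MeasurableSpace Ω] (μ : Measure Ω) [IsProbabilityMeasure μ]
        (X : Fin n → Ω → EuclideanSpace ℝ (Fin p)),
        (∀ i, Measurable (X i)) →
        iIndepFun X μ →
        (∀ i j, ∫ ω, X i ω j ∂μ = 0) →
        (∀ i j, Integrable (fun ω => |X i ω j| ^ 3) μ) →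
        MaxCoupling.HasIndepUniform μ (fun ω i => X i ω) →
      ∀ (Ω' : Type*) [MeasurableSpace Ω'] (μ' : Measure Ω') [IsProbabilityMeasure μ']
        (Y : Fin n → Ω' → EuclideanSpace ℝ (Fin p)),
        iIndepFun Y μ' →
        (∀ i, HasLaw (Y i) (multivariateGaussian 0 (MaxCoupling.secondMoment μ (X i))) μ') →
      ∀ δ : ℝ, 0 < δ →
        ∃ Z' : Ω → ℝ, Measurable Z' ∧
          IdentDistrib Z' (fun ω' => MaxCoupling.maxCoord (∑ i, Y i ω')) μ μ' ∧
          μ.real {ω | 16 * δ < |MaxCoupling.maxCoord (∑ i, X i ω) - Z' ω|} ≤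
            C * (δ⁻¹ ^ 2 *
                (MaxCoupling.B₁ μ X +
                  δ⁻¹ * (MaxCoupling.B₂ μ X + MaxCoupling.B₄ μ X δ) *
                    Real.log (max (p : ℝ) (n : ℝ))) *
                Real.log (max (p : ℝ) (n : ℝ)) +
              Real.log n / n) := by
  obtain ⟨M, hM, hcut⟩ := exists_smooth_cutoff
  -- The first summand is the constant of `comparison_error_le`; the 1 pays for the term log n / n.
  refine ⟨16 * M * Real.exp 2 + 1, by positivity, ?_⟩
  intro n p hn hp Ω _ μ _ X hXm hind hX0 hX3 hU Ω' _ μ' _ Y hYind hY δ hδ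
  have : NeZero p := ⟨by omega⟩
  have hL := one_le_log_max (p := p) hn
  set L := Real.log (max (p : ℝ) (n : ℝ))
  have hL0 : 0 < L := by linarith
  have hβ : 0 < L / δ := by positivity
  have hlog : (L / δ)⁻¹ * Real.log (Fintype.card (Fin p)) ≤ δ := by
    have : Real.log p ≤ L := Real.log_le_log (by exact_mod_cast hp) (le_max_left _ _)
    rw [Fintype.card_fin, inv_div, div_mul_eq_mul_div, div_le_iff₀ hL0]
    gcongr
  have hofLp : Measurable (WithLp.ofLp : EuclideanSpace ℝ (Fin p) → Fin p → ℝ) :=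
    WithLp.measurable_ofLp 2 (Fin p → ℝ)
  have hsup : Measurable fun y : Fin p → ℝ => ⨆ j, y j := Measurable.iSup measurable_pi_apply
  have hWX : Measurable fun ω => ∑ i, (X i ω).ofLp :=
    Finset.measurable_fun_sum _ fun i _ => hofLp.comp (hXm i)
  have hZeq : ∀ ω, maxCoord (∑ i, X i ω) = ⨆ j, (∑ i, (X i ω).ofLp) j := fun ω => by
    rw [maxCoord, WithLp.ofLp_sum]
  have hZ : Measurable fun ω => maxCoord (∑ i, X i ω) := by
    simp only [hZeq]; exact hsup.comp hWX
  have hUZ : HasIndepUniform μ fun ω => maxCoord (∑ i, X i ω) := by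
    obtain ⟨U, hUm, hUu, hUi⟩ := hU
    refine ⟨U, hUm, hUu, hUi.comp (φ := id)
      (ψ := fun x : Fin n → EuclideanSpace ℝ (Fin p) => maxCoord (∑ i, x i)) measurable_id ?_⟩
    exact hsup.comp (hofLp.comp (Finset.measurable_fun_sum _ fun i _ => measurable_pi_apply i))
  have hX2 : ∀ i j, MemLp (fun ω => X i ω j) 2 μ := fun i j => memLp_two_of_integrable_cube
    (((measurable_pi_apply j).comp (hofLp.comp (hXm i))).aestronglyMeasurable) (hX3 i j)
  obtain ⟨hYG, hY0, hYc⟩ := law_sum_multivariateGaussian hYind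
    (fun i => posSemidef_secondMoment (hX2 i)) hY
  set γ : Measure (Fin p → ℝ) := μ'.map fun ω' j => (∑ i, Y i ω') j with hγdef
  have hYm := hYG.aemeasurable
  have : IsGaussian γ := hYG.isGaussian_map
  have hγ0 : ∫ y, y ∂γ = 0 := by
    exact (integral_map (f := fun y => y) hYm measurable_id.aestronglyMeasurable).trans hY0
  have hγc : ∀ j k, ∫ y, y j * y k ∂γ = ∑ i, secondMoment μ (X i) j k := fun j k => by
    rw [hγdef, integral_map hYm (Measurable.aestronglyMeasurable (by fun_prop))]; exact hYc j k
  have hν : γ.map (fun y => ⨆ j, y j) = μ'.map fun ω' => maxCoord (∑ i, Y i ω') :=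
    AEMeasurable.map_map_of_aemeasurable hsup.aemeasurable hYm
  have : IsProbabilityMeasure (γ.map fun y : Fin p → ℝ => ⨆ j, y j) :=
    Measure.isProbabilityMeasure_map hsup.aemeasurable
  set E := δ⁻¹ ^ 2 * (B₁ μ X + δ⁻¹ * (B₂ μ X + B₄ μ X δ) * L) * L
  have hB₁ := B₁_nonneg μ X
  have hB₂ := B₂_nonneg μ X
  have hB₄ := B₄_nonneg μ X δ
  have hE0 : 0 ≤ E := by positivity
  have hη : 0 < Real.log n / n := by
    have : (1 : ℝ) < n := by exact_mod_cast (by omega : 1 < n)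
    exact div_pos (Real.log_pos this) (by linarith)
  -- The positive quantity log n / n serves as the slack η lost to rounding and truncation in the
  -- coupling.
  obtain ⟨Z', hZ'm, hZ'ν, hZ'⟩ := exists_grid_coupling hZ hUZ (γ.map fun y => ⨆ j, y j)
    (ε := 16 * M * Real.exp 2 * E) hδ (by positivity) hη fun S => by
      obtain ⟨g, g₁, g₂, g₃, d, d₁, d₂, b₁, b₂, b₃, hg0, hg1, hgS, hgS'⟩ := hcut S δ hδ
      have hB : BoundedDerivs g g₁ g₂ g₃ (M * δ⁻¹) (M * δ⁻¹ ^ 2) (M * δ⁻¹ ^ 3) :=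
        ⟨d, d₁, d₂, b₁, b₂, b₃⟩
      have hc := (abs_le.mp ((abs_integral_smoothMax_sum_sub_le hXm hind hX0 hX3 γ hγ0 hγc hB
        (fun t => by rw [abs_of_nonneg (hg0 t)]; exact hg1 t) hδ hL0).trans
        (comparison_error_le hM hL hδ hB₁ hB₂ hB₄))).2
      have h1 := measureReal_floor_mem_le_integral (μ := μ) hWX hδ hβ hlog hB.continuous hg0 hg1 hgS
      have h2 := integral_le_measureReal_floor (μ := γ) measurable_id hδ hβ hlog hB.continuous
        hg0 hg1 hgS'
      have hs : MeasurableSet {y : ℝ | ∃ k ∈ S, |⌊y / δ⌋ - k| ≤ 2} :=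
        (Int.measurable_floor.comp (measurable_id.div_const δ))
          (MeasurableSet.of_discrete (s := {l : ℤ | ∃ k ∈ S, |l - k| ≤ 2}))
      rw [map_measureReal_apply hsup hs]
      simp only [hZeq]
      simp only [id] at h2
      change _ ≤ γ.real {y | ∃ k ∈ S, |⌊(⨆ j, y j) / δ⌋ - k| ≤ 2} + _
      linarith
  refine ⟨Z', hZ'm, ⟨hZ'm.aemeasurable, hsup.comp_aemeasurable hYm, hZ'ν.trans hν⟩, ?_⟩
  -- The coupling is within 3δ, which is stronger than the required 16δ.
  refine (measureReal_mono fun ω hω => ?_).trans (hZ'.trans ?_)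
  · have : 16 * δ < |maxCoord (∑ i, X i ω) - Z' ω| := hω
    change 3 * δ < |maxCoord (∑ i, X i ω) - Z' ω|
    linarith
  · have : 0 ≤ 16 * M * Real.exp 2 := by positivity
    nlinarith [mul_nonneg this hη.le]
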